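/- **Theorem (non-Archimedean analog of the Stone theorem).** Let $K$ be a locally compact field with a non-trivial non-Archimedean valuation, and let $A$ be a commutative Banach $C$-algebra over $K$, i.e. a commutative Banach algebra isometrically isomorphic to the algebra $C_\infty(X,K)$ of continuous functions vanishing at infinity (pointwise operations, supremum norm) for some locally compact Hausdorff totally disconnected space $X$. Let $a\mapsto a^t$ be a transposition on $A$ (a $K$-linear involutive anti-homomorphism) making $A$ an $E$-algebra, $\|a^ta\|=\|a\|^2$ (for instance $a^t=a$). Let $\hat A$ be the symmetric spectrum: the set of nonzero algebra homomorphisms $\phi:A\to K$ with $\phi(a^t)=\phi(a)$ for all $a$, with the topology of pointwise convergence, and put $\hat a(\phi)=\phi(a)$. Let $H$ be a (non-Archimedean) Banach space over $K$ and $\mathcal L(H)$ its algebra of bounded operators. An *$H$-projection-valued tight measure* on $\hat A$ is a map $P:\mathsf L\to\mathcal L(H)$ on an algebra $\mathsf L$ of subsets of $\hat A$ containing all clopen sets, such that every $P(V)$ is idempotent, $P(\hat A)=1_H$, $P(\emptyset)=0$, $\sup_{V\in\mathsf L}\|P(V)\|<\infty$, $P(V)P(W)=0$ and $P(V\cup W)=P(V)+P(W)$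 for disjoint $V,W\in\mathsf L$, and $\lim_{V\in\mathcal S}P(V)=0$ in the strong operator topology for every non-empty downward directed $\mathcal S\subseteq\mathsf L$ with $\bigcap\mathcal S=\emptyset$. It is *regular* if, for each $V\in\mathsf L$, the range of $P(V)$ is the least closed subspace containing the ranges of all $P(C)$ with $C\in\mathsf L$ compact, $C\subseteq V$. The spectral integral $\int f\,dP$ is the operator-norm limit of $\int s_n\,dP$, where $\int\sum_i\lambda_i\mathrm{Ch}_{B_i}\,dP=\sum_i\lambda_iP(B_i)$ ($B_i\in\mathsf L$, $\lambda_i\in K$, finite sums) and the $s_n$ are such simple functions converging to $f$ uniformly off $P$-null sets. A *non-degenerate representation* of $A$ on $H$ is a continuous algebra homomorphism $T:A\to\mathcal L(H)$ for which the vectors $T_a\xi$ ($a\in A$, $\xi\in H$) span a dense subspace of $H$. 1. If $P$ is a regular $H$-projection-valued tight measure on $\hat A$, then for every $a\in A$ the spectral integral $$T_a=\int_{\hat A}\hat a(\phi)\,P(d\phi)\qquad(i)$$ exists and is unique, and $T$ is a non-degenerate representation of $A$ on $H$. 2. Conversely, for every non-degenerate representation $T$ of $A$ on $H$ there is a regular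 $H$-projection-valued tight measure $P$ on the algebra of clopen subsets of $\hat A$ such that $(i)$ holds for all $a\in A$. It is unique; more generally, any two regular $H$-projection-valued tight measures on $\hat A$, defined on algebras $\mathsf L$ and $\mathsf L'$ of subsets, that satisfy $(i)$ for the same $T$ coincide on $\mathsf L\cap\mathsf L'$. 3. When $T$ and $P$ are related by $(i)$, $\|T_a\|\le\|a\|$ for all $a\in A$ if and only if $\|P(V)\|\le1$ for all $V\in\mathsf L$. -/

import Mathlib

open scoped ZeroAtInfty

universe u v w x

namespace NonArchSpectral

/-! ### Algebras -/

section Algebras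

variable (K : Type u) [NontriviallyNormedField K]
variable {A : Type v} [NonUnitalNormedCommRing A] [NormedSpace K A]

/-- An operation of transposition on `A`: a `K`-linear involutive anti-homomorphism. -/
structure IsTransposition (tr : A → A) : Prop where
  map_add : ∀ a b, tr (a + b) = tr a + tr b
  map_smul : ∀ (c : K) (a : A), tr (c • a) = c • tr a
  map_mul : ∀ a b, tr (a * b) = tr b * tr a
  involutive : ∀ a, tr (tr a) = a

/-- `A`, with the transposition `tr`, is an `E`-algebra: `‖aᵗ a‖ = ‖a‖ ^ 2`. -/
structure IsETransposition (tr : A → A) : Prop extends IsTransposition K tr where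
  norm_mul_self : ∀ a, ‖tr a * a‖ = ‖a‖ ^ 2

variable (A) in
/-- `A` is a `C`-algebra: it is isometrically isomorphic, as an algebra over `K`, to the algebra
`C_∞(X, K)` of continuous functions vanishing at infinity, with pointwise operations and the
supremum norm, for some locally compact Hausdorff totally (hereditarily) disconnected `X`. -/
def IsCAlgebra : Prop :=
  ∃ (X : Type w) (_ : TopologicalSpace X) (_ : LocallyCompactSpace X) (_ : T2Space X)
    (_ : TotallyDisconnectedSpace X) (e : A →ₙₐ[K] C₀(X, K)),
    Isometry e ∧ Function.Surjective e

/-- The symmetric spectrum of `A`: all nonzero algebra homomorphisms `φ : A → K` (no continuity is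
imposed) such that `φ (aᵗ) = φ a` for every `a`. -/
def SymmSpectrum (tr : A → A) : Type (max u v) :=
  {φ : A →ₙₐ[K] K // φ ≠ 0 ∧ ∀ a, φ (tr a) = φ a}

/-- The topology of pointwise convergence, that is, of a subspace of `K ^ A`. -/
instance (tr : A → A) : TopologicalSpace (SymmSpectrum K tr) :=
  TopologicalSpace.induced (fun φ => (fun a : A => φ.1 a)) inferInstance

/-- The Gelfand transform `â` of `a`, as a function on the symmetric spectrum. -/
def gelfand (tr : A → A) (a : A) : SymmSpectrum K tr → K := fun φ => φ.1 a

variable {K}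

/-- Non-degenerate representations of `A` on `H`: continuous algebra homomorphisms into the bounded
operators such that the vectors `T_a ξ` span a dense subspace of `H`. -/
structure IsNondegenerateRep {H : Type x} [NormedAddCommGroup H] [NormedSpace K H]
    (T : A →ₙₐ[K] (H →L[K] H)) : Prop where
  continuous : Continuous T
  dense_span : (Submodule.span K {η : H | ∃ (a : A) (ξ : H), η = T a ξ}).topologicalClosure = ⊤

end Algebras

/-! ### Projection-valued measures and the spectral integral

`P : Set X → (H →L[K] H)` stands for a function on a family `L` of subsets of `X`; its values outside
`L` are never used. -/

section Measures

variable {K : Type u} [NontriviallyNormedField K]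
variable {X : Type v}
variable {H : Type x} [NormedAddCommGroup H] [NormedSpace K H]

/-- `P` is an `H`-projection-valued measure on the algebra `L` of subsets of `X`. -/
structure IsProjectionMeasure (L : Set (Set X)) (P : Set X → (H →L[K] H)) : Prop where
  isSetAlgebra : MeasureTheory.IsSetAlgebra L
  /-- the values are projections (continuous idempotents) -/
  idem : ∀ A ∈ L, P A * P A = P A
  map_univ : P Set.univ = 1
  map_empty : P ∅ = 0
  mul_of_disjoint : ∀ A ∈ L, ∀ B ∈ L, Disjoint A B → P A * P B = 0
  map_union : ∀ A ∈ L, ∀ B ∈ L, Disjoint A B → P (A ∪ B) = P A + P B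
  bounded : ∃ M : ℝ, ∀ A ∈ L, ‖P A‖ ≤ M
  /-- if `S ⊆ L` is shrinking (directed downwards) and has empty intersection, then `P A` tends to
  `0` along `A ∈ S` in the strong operator topology -/
  tendsto_zero : ∀ S ⊆ L, S.Nonempty → DirectedOn (fun A B => B ⊆ A) S → ⋂₀ S = ∅ →
    ∀ ξ : H, ∀ ε > (0 : ℝ), ∃ A₀ ∈ S, ∀ A ∈ S, A ⊆ A₀ → ‖P A ξ‖ < ε

/-- A projection-valued measure is tight if its algebra contains all clopen sets, and regular if
`P A` is the supremum of the `P C` with `C ⊆ A` compact: its range is the least closed subspace that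
contains the ranges of these `P C`. -/
structure IsRegularTight [TopologicalSpace X] (L : Set (Set X)) (P : Set X → (H →L[K] H)) :
    Prop extends IsProjectionMeasure L P where
  clopen_mem : ∀ A, IsClopen A → A ∈ L
  regular : ∀ A ∈ L, LinearMap.range (P A : H →ₗ[K] H) =
    (⨆ C ∈ {C : Set X | C ∈ L ∧ IsCompact C ∧ C ⊆ A},
      LinearMap.range (P C : H →ₗ[K] H)).topologicalClosure

/-- The simple function `∑ i, c i • Ch_{B i}`. -/
noncomputable def simpleFunction {n : ℕ} (c : Fin n → K) (B : Fin n → Set X) (t : X) : K :=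
  ∑ i, (B i).indicator (fun _ => c i) t

/-- The integral `∑ i, c i • P (B i)` of a simple function. -/
noncomputable def simpleIntegral (P : Set X → (H →L[K] H)) {n : ℕ} (c : Fin n → K) (B : Fin n → Set X) :
    H →L[K] H :=
  ∑ i, c i • P (B i)

/-- `‖f‖_∞ ≤ r` for the `P`-essential supremum: `|f| ≤ r` off a `P`-null set. -/
def EssBoundedBy (L : Set (Set X)) (P : Set X → (H →L[K] H)) (f : X → K) (r : ℝ) : Prop :=
  ∃ N ∈ L, P N = 0 ∧ ∀ t ∉ N, ‖f t‖ ≤ r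

/-- `E` is the spectral integral `∫ f(x) P(dx)`: there are simple functions over `L` that converge to
`f` in the `P`-essential supremum norm and whose integrals converge to `E` in operator norm. -/
def HasSpectralIntegral (L : Set (Set X)) (P : Set X → (H →L[K] H)) (f : X → K)
    (E : H →L[K] H) : Prop :=
  ∀ ε > (0 : ℝ), ∃ (n : ℕ) (c : Fin n → K) (B : Fin n → Set X), (∀ i, B i ∈ L) ∧
    EssBoundedBy L P (fun t => f t - simpleFunction c B t) ε ∧ ‖E - simpleIntegral P c B‖ ≤ ε

end Measures

end NonArchSpectral

/-!
The proof reduces to the algebra `C₀(X, K)` with the trivial transposition. In a `C`-algebra the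
idempotents (the characteristic functions of compact open sets) span a dense subspace. The identity
`‖aᵗ a‖ = ‖a‖ ^ 2` makes the transposition isometric and forces it to fix every idempotent, so it is
the identity. A nonzero character of `C₀(X, K)` is automatically continuous, and by compactness it
is an evaluation. Hence the symmetric spectrum is homeomorphic to `X`, and the Gelfand transform is
an isometric isomorphism of `A` onto the functions on the spectrum that vanish at infinity
(`exists_homeomorph_symmSpectrum`, `exists_gelfand_hom`).

*From `P` to `T`.* As the norm of `H` is ultrametric, the integral of a simple function of essential
supremum `r` has norm at most `r * M`, where `M` bounds the norms of the values of `P`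
(`norm_simpleIntegral_le`). So integration extends uniquely and multiplicatively to uniform limits
of simple functions, among them all functions in `C₀(X, K)`. Regularity on the whole space gives
non-degeneracy (`IsRegularTight.exists_rep`).

*From `T` to `P`.* Non-degeneracy and the density of the span of the idempotents make the operators
`T (Ch_U)`, with `U` compact open, an approximate unit that fixes a dense set of vectors. Therefore
`P V = lim_U T (Ch_(U ∩ V))` exists strongly for each clopen `V`, and it is the only operator such
that `P V * T (Ch_U) = T (Ch_(U ∩ V))` for all `U`, an identity from which all properties of `P`
follow (`IsNondegenerateRep.exists_measure`).

*Uniqueness and norms.* `T` determines `P` on the compact open sets. Tightness makes the value at a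
compact set a strong limit of values at compact open sets, and regularity makes a general value a
strong limit of values at compact sets, which gives the bound `‖P V‖ ≤ 1`
(`IsRegularTight.norm_le_of_forall_compactOpen`). Two measures `P` and `P'` may be defined on
different algebras, so their compact sets cannot be compared directly. Instead, the separation of
disjoint compact sets by a compact open set shows `P V * P' Vᶜ = 0` and `P Vᶜ * P' V = 0`, so that
`P V = P V * P' V = P' V` (`IsRegularTight.eq_of_forall_compactOpen`).
-/

namespace NonArchSpectral

/-! ### Compact open sets and functions vanishing at infinity -/

section Functions

open TopologicalSpace

variable {K : Type u} [NontriviallyNormedField K]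
variable {X : Type v} [TopologicalSpace X]

theorem norm_apply_le (f : C₀(X, K)) (t : X) : ‖f t‖ ≤ ‖f‖ :=
  f.toBCF.norm_coe_le_norm t

theorem norm_le_of_forall_apply {f : C₀(X, K)} {r : ℝ} (hr : 0 ≤ r) (h : ∀ t, ‖f t‖ ≤ r) :
    ‖f‖ ≤ r :=
  (BoundedContinuousFunction.norm_le (f := f.toBCF) hr).2 h

theorem coe_sum {ι : Type*} (s : Finset ι) (f : ι → C₀(X, K)) (t : X) :
    (∑ i ∈ s, f i) t = ∑ i ∈ s, f i t := by
  classical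
  induction s using Finset.induction_on with
  | empty => simp
  | insert a s ha ih => simp [Finset.sum_insert ha, ih]

/-- Outside a compact set, a function vanishing at infinity is small. -/
theorem isCompact_norm_ge (f : C₀(X, K)) {ε : ℝ} (hε : 0 < ε) : IsCompact {t | ε ≤ ‖f t‖} := by
  have h : ∀ᶠ t in Filter.cocompact X, ‖f t‖ < ε := by
    have := (f.zero_at_infty').eventually (Metric.ball_mem_nhds (0 : K) hε)
    filter_upwards [this] with t ht
    simpa using ht
  obtain ⟨C, hC, hsub⟩ := Filter.mem_cocompact.1 h
  refine hC.of_isClosed_subset (isClosed_le continuous_const (map_continuous f).norm) ?_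
  intro t ht
  by_contra hn
  have h' : ‖f t‖ < ε := hsub hn
  exact absurd h' (not_lt.2 ht)

variable [T2Space X]

theorem isClopen_compactOpen (U : CompactOpens X) : IsClopen (U : Set X) :=
  ⟨U.isCompact.isClosed, U.isOpen⟩

/-- The characteristic function of a compact open set. -/
noncomputable def compactOpenChar (U : CompactOpens X) : C₀(X, K) where
  toFun := (U : Set X).indicator fun _ => 1
  continuous_toFun := (isClopen_compactOpen U).continuous_indicator continuous_const
  zero_at_infty' := by
    refine tendsto_const_nhds.congr' ?_
    filter_upwards [U.isCompact.compl_mem_cocompact] with t ht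
    exact (Set.indicator_of_notMem ht _).symm

@[simp] theorem compactOpenChar_apply (U : CompactOpens X) (t : X) :
    compactOpenChar (K := K) U t = (U : Set X).indicator (fun _ => 1) t := rfl

theorem norm_compactOpenChar_le (U : CompactOpens X) : ‖compactOpenChar (K := K) U‖ ≤ 1 :=
  norm_le_of_forall_apply zero_le_one fun t => by
    rw [compactOpenChar_apply]
    exact (norm_indicator_le_norm_self _ _).trans (by simp)

theorem compactOpenChar_mul_self (U : CompactOpens X) :
    compactOpenChar (K := K) U * compactOpenChar U = compactOpenChar U := by
  ext t
  by_cases h : t ∈ (U : Set X) <;> simp [h]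

/-- The intersection of a compact open set with a clopen set. -/
def compactOpenInter (U : CompactOpens X) (V : Set X) (hV : IsClopen V) : CompactOpens X where
  carrier := (U : Set X) ∩ V
  isCompact' := U.isCompact.inter_right hV.isClosed
  isOpen' := U.isOpen.inter hV.isOpen

omit [T2Space X] in
@[simp] theorem coe_compactOpenInter (U : CompactOpens X) (V : Set X) (hV : IsClopen V) :
    (compactOpenInter U V hV : Set X) = (U : Set X) ∩ V := rfl

section Separation

variable [LocallyCompactSpace X] [TotallyDisconnectedSpace X]

theorem exists_compactOpen_mem_subset {t : X} {W : Set X} (hW : IsOpen W) (ht : t ∈ W) :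
    ∃ U : CompactOpens X, t ∈ U ∧ (U : Set X) ⊆ W := by
  obtain ⟨C, hC, htC, hCW⟩ := exists_compact_subset hW ht
  obtain ⟨V, hV, htV, hVC⟩ :=
    (loc_compact_Haus_tot_disc_of_zero_dim (H := X)).exists_subset_of_mem_open htC isOpen_interior
  have hV' : IsClopen V := hV
  exact ⟨⟨⟨V, hC.of_isClosed_subset hV'.isClosed (hVC.trans interior_subset)⟩, hV'.isOpen⟩,
    htV, hVC.trans (interior_subset.trans hCW)⟩

theorem exists_compactOpen_between {C W : Set X} (hC : IsCompact C) (hW : IsOpen W) (h : C ⊆ W) :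
    ∃ U : CompactOpens X, C ⊆ U ∧ (U : Set X) ⊆ W := by
  refine hC.induction_on (p := fun s => ∃ U : CompactOpens X, s ⊆ U ∧ (U : Set X) ⊆ W)
    ⟨⊥, by simp, by simp⟩ ?_ ?_ ?_
  · rintro s s' hs ⟨U, h1, h2⟩
    exact ⟨U, hs.trans h1, h2⟩
  · rintro s s' ⟨U, h1, h2⟩ ⟨U', h1', h2'⟩
    refine ⟨U ⊔ U', ?_, ?_⟩
    · rw [CompactOpens.coe_sup]
      exact Set.union_subset_union h1 h1'
    · rw [CompactOpens.coe_sup]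
      exact Set.union_subset h2 h2'
  · intro t ht
    obtain ⟨U, htU, hUW⟩ := exists_compactOpen_mem_subset hW (h ht)
    exact ⟨U, mem_nhdsWithin_of_mem_nhds (U.isOpen.mem_nhds htU), U, subset_rfl, hUW⟩

end Separation

/-- The locally constant functions with compact support (spanned by the characteristic functions of
the compact open sets) are dense: `{ε ≤ ‖f‖}` is compact and open, and finitely many balls of radius
`ε`, which in an ultrametric space are pairwise equal or disjoint, cover its image under `f`. -/
theorem exists_mem_span_char_norm_sub_le [IsUltrametricDist K] (f : C₀(X, K)) {ε : ℝ}
    (hε : 0 < ε) :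
    ∃ s ∈ Submodule.span K (Set.range (compactOpenChar (K := K) (X := X))), ‖f - s‖ ≤ ε := by
  classical
  set K₀ : Set X := {t | ε ≤ ‖f t‖} with hK₀
  have hcomp : IsCompact K₀ := isCompact_norm_ge f hε
  have hopen : IsOpen K₀ := by
    have : K₀ = (f ⁻¹' Metric.ball 0 ε)ᶜ := by
      ext t; simp [hK₀]
    rw [this]
    exact ((IsUltrametricDist.isClosed_ball (0 : K) ε).preimage
      (map_continuous f)).isOpen_compl
  obtain ⟨Y, -, hY⟩ := (hcomp.image (map_continuous f)).elim_nhds_subcover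
    (fun y => Metric.ball y ε) fun y _ => Metric.ball_mem_nhds y hε
  let 𝓑 : Finset (Set K) := Y.image fun y => Metric.ball y ε
  have hball : ∀ B ∈ 𝓑, ∃ y, B = Metric.ball y ε := by
    intro B hB
    obtain ⟨y, -, rfl⟩ := Finset.mem_image.1 hB
    exact ⟨y, rfl⟩
  let U : Set K → CompactOpens X := fun B => if h : IsClopen B then
    ⟨⟨K₀ ∩ f ⁻¹' B, hcomp.inter_right (h.isClosed.preimage (map_continuous f))⟩,
      hopen.inter (h.isOpen.preimage (map_continuous f))⟩ else ⊥
  have hU : ∀ B ∈ 𝓑, (U B : Set X) = K₀ ∩ f ⁻¹' B := by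
    intro B hB
    obtain ⟨y, rfl⟩ := hball B hB
    simp only [U, dif_pos (IsUltrametricDist.isClopen_ball y ε)]
    rfl
  let c : Set K → K := fun B => if h : ∃ y, B = Metric.ball y ε then h.choose else 0
  have hc : ∀ B ∈ 𝓑, B = Metric.ball (c B) ε := by
    intro B hB
    have h := hball B hB
    simp only [c, dif_pos h]
    exact h.choose_spec
  refine ⟨∑ B ∈ 𝓑, c B • compactOpenChar (U B), Submodule.sum_mem _ fun B _ =>
    Submodule.smul_mem _ _ (Submodule.subset_span ⟨_, rfl⟩),
    norm_le_of_forall_apply hε.le fun t => ?_⟩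
  rw [ZeroAtInftyContinuousMap.sub_apply, coe_sum]
  by_cases ht : t ∈ K₀
  · obtain ⟨y, hy, hty⟩ := Set.mem_iUnion₂.1 (hY ⟨t, ht, rfl⟩)
    have hB : Metric.ball y ε ∈ 𝓑 := Finset.mem_image_of_mem _ hy
    rw [Finset.sum_eq_single_of_mem _ hB]
    · have htU : t ∈ (U (Metric.ball y ε) : Set X) := by rw [hU _ hB]; exact ⟨ht, hty⟩
      have h1 : f t ∈ Metric.ball (c (Metric.ball y ε)) ε := by rw [← hc _ hB]; exact hty
      simpa [htU, dist_eq_norm] using (Metric.mem_ball.1 h1).le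
    · intro B hB' hne
      have htU : t ∉ (U B : Set X) := by
        rw [hU _ hB']
        rintro ⟨-, htB⟩
        obtain ⟨z, rfl⟩ := hball B hB'
        exact hne ((IsUltrametricDist.ball_eq_of_mem htB).trans
          (IsUltrametricDist.ball_eq_of_mem hty).symm)
      simp [htU]
  · rw [Finset.sum_eq_zero]
    · have : ‖f t‖ < ε := not_le.1 ht
      simpa using this.le
    · intro B hB
      have htU : t ∉ (U B : Set X) := by
        rw [hU _ hB]
        exact fun h => ht h.1
      simp [htU]

end Functions

/-! ### Integration of essentially simple functions -/

section Integration

variable {K : Type u} [NontriviallyNormedField K]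
variable {X : Type v}
variable {H : Type x} [NormedAddCommGroup H] [NormedSpace K H]
variable {L : Set (Set X)} {P : Set X → (H →L[K] H)}

namespace IsProjectionMeasure

theorem map_inter_add_map_sdiff (hP : IsProjectionMeasure L P) {A B : Set X} (hA : A ∈ L)
    (hB : B ∈ L) : P (A ∩ B) + P (A \ B) = P A := by
  rw [← hP.map_union _ (hP.isSetAlgebra.inter_mem hA hB) _ (hP.isSetAlgebra.sdiff_mem hA hB)
    (Set.disjoint_sdiff_inter.symm), Set.inter_union_sdiff]

theorem map_inter (hP : IsProjectionMeasure L P) {A B : Set X} (hA : A ∈ L) (hB : B ∈ L) :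
    P (A ∩ B) = P A * P B := by
  have hAB := hP.isSetAlgebra.inter_mem hA hB
  have hA' := hP.isSetAlgebra.sdiff_mem hA hB
  have hB' := hP.isSetAlgebra.sdiff_mem hB hA
  have h1 := hP.map_inter_add_map_sdiff hA hB
  have h2 := hP.map_inter_add_map_sdiff hB hA
  rw [Set.inter_comm] at h2
  rw [← h1, ← h2, add_mul, mul_add, mul_add, hP.idem _ hAB,
    hP.mul_of_disjoint _ hAB _ hB' (Set.disjoint_left.2 fun t ht ht' => ht'.2 ht.1),
    hP.mul_of_disjoint _ hA' _ hAB (Set.disjoint_left.2 fun t ht ht' => ht.2 ht'.2),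
    hP.mul_of_disjoint _ hA' _ hB' (Set.disjoint_left.2 fun t ht ht' => ht.2 ht'.1)]
  simp

theorem map_compl (hP : IsProjectionMeasure L P) {A : Set X} (hA : A ∈ L) :
    P Aᶜ = 1 - P A := by
  rw [eq_sub_iff_add_eq', ← hP.map_union _ hA _ (hP.isSetAlgebra.compl_mem hA)
    disjoint_compl_right, Set.union_compl_self, hP.map_univ]

theorem mul_of_subset (hP : IsProjectionMeasure L P) {A B : Set X} (hA : A ∈ L) (hB : B ∈ L)
    (h : A ⊆ B) : P A * P B = P A := by
  rw [← hP.map_inter hA hB, Set.inter_eq_left.2 h]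

theorem mul_of_superset (hP : IsProjectionMeasure L P) {A B : Set X} (hA : A ∈ L) (hB : B ∈ L)
    (h : A ⊆ B) : P B * P A = P A := by
  rw [← hP.map_inter hB hA, Set.inter_eq_right.2 h]

theorem eq_zero_of_subset (hP : IsProjectionMeasure L P) {A N : Set X} (hA : A ∈ L) (hN : N ∈ L)
    (h0 : P N = 0) (h : A ⊆ N) : P A = 0 := by
  rw [← hP.mul_of_subset hA hN h, h0, mul_zero]

theorem union_eq_zero (hP : IsProjectionMeasure L P) {N N' : Set X} (hN : N ∈ L) (hN' : N' ∈ L)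
    (h : P N = 0) (h' : P N' = 0) : P (N ∪ N') = 0 := by
  have hd := hP.isSetAlgebra.sdiff_mem hN' hN
  rw [← Set.union_sdiff_self, hP.map_union _ hN _ hd Set.disjoint_sdiff_right, h,
    hP.eq_zero_of_subset hd hN' h' Set.sdiff_subset, add_zero]

theorem apply_eq_self_of_mem_range (hP : IsProjectionMeasure L P) {C : Set X}
    (hC : C ∈ L) {η : H} (h : η ∈ LinearMap.range (P C : H →ₗ[K] H)) : P C η = η := by
  obtain ⟨ζ, rfl⟩ := h
  exact congrArg (fun E : H →L[K] H => E ζ) (hP.idem C hC)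

theorem bound_nonneg (hP : IsProjectionMeasure L P) {M : ℝ} (hM : ∀ A ∈ L, ‖P A‖ ≤ M) : 0 ≤ M :=
  (norm_nonneg _).trans (hM _ hP.isSetAlgebra.empty_mem)

/-- The generalization of the bound for integrals of simple functions that carries the induction
on the number of sets: the set `W` is cut by the first of the sets, and the coefficient of this set
is moved to the constant `c₀` on the part of `W` inside of it. -/
theorem norm_const_add_simpleIntegral_le [IsUltrametricDist H] (hP : IsProjectionMeasure L P)
    {M : ℝ} (hM : ∀ A ∈ L, ‖P A‖ ≤ M) {N : Set X} (hN : N ∈ L) (hN0 : P N = 0) {r : ℝ}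
    (hr : 0 ≤ r) (n : ℕ) :
    ∀ (c : Fin n → K) (B : Fin n → Set X), (∀ i, B i ∈ L) → ∀ (c₀ : K), ∀ W ∈ L,
      (∀ t ∈ W, t ∉ N → ‖c₀ + simpleFunction c B t‖ ≤ r) → ∀ ξ : H,
      ‖c₀ • P W ξ + simpleIntegral P c B (P W ξ)‖ ≤ r * M * ‖ξ‖ := by
  have hM0 := hP.bound_nonneg hM
  induction n with
  | zero =>
    intro c B hB c₀ W hW h ξ
    simp only [simpleFunction, simpleIntegral, Finset.univ_eq_empty, Finset.sum_empty,
      add_zero, zero_apply] at h ⊢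
    by_cases hWN : W ⊆ N
    · rw [hP.eq_zero_of_subset hW hN hN0 hWN]
      simpa using by positivity
    · obtain ⟨t, htW, htN⟩ := Set.not_subset.1 hWN
      rw [norm_smul, mul_assoc]
      exact mul_le_mul (h t htW htN) ((P W).le_of_opNorm_le (hM W hW) ξ) (norm_nonneg _) hr
  | succ n ih =>
    intro c B hB c₀ W hW h ξ
    set c' : Fin n → K := fun i => c i.succ
    set B' : Fin n → Set X := fun i => B i.succ
    have hB' : ∀ i, B' i ∈ L := fun i => hB _
    have hin := hP.isSetAlgebra.inter_mem hW (hB 0)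
    have hout := hP.isSetAlgebra.sdiff_mem hW (hB 0)
    have hf : ∀ t, simpleFunction c B t =
        (B 0).indicator (fun _ => c 0) t + simpleFunction c' B' t := fun t => by
      simp [simpleFunction, Fin.sum_univ_succ, c', B']
    have hI : simpleIntegral P c B = c 0 • P (B 0) + simpleIntegral P c' B' := by
      simp [simpleIntegral, Fin.sum_univ_succ, c', B']
    have h1 := ih c' B' hB' (c₀ + c 0) _ hin (fun t ht htN => by
      have := h t ht.1 htN
      rwa [hf, Set.indicator_of_mem ht.2, ← add_assoc] at this) ξ
    have h2 := ih c' B' hB' c₀ _ hout (fun t ht htN => by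
      have := h t ht.1 htN
      rwa [hf, Set.indicator_of_notMem ht.2, zero_add] at this) ξ
    have hW' : P W ξ = P (W ∩ B 0) ξ + P (W \ B 0) ξ := by
      rw [← hP.map_inter_add_map_sdiff hW (hB 0), add_apply]
    have hB0 : P (B 0) (P W ξ) = P (W ∩ B 0) ξ := by
      rw [Set.inter_comm, hP.map_inter (hB 0) hW, mul_apply_eq_comp]
    have key : c₀ • P W ξ + simpleIntegral P c B (P W ξ) =
        ((c₀ + c 0) • P (W ∩ B 0) ξ + simpleIntegral P c' B' (P (W ∩ B 0) ξ)) +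
          (c₀ • P (W \ B 0) ξ + simpleIntegral P c' B' (P (W \ B 0) ξ)) := by
      rw [hI, add_apply, smul_apply, hB0, hW', map_add,
        smul_add, add_smul]
      abel
    rw [key]
    exact (IsUltrametricDist.norm_add_le_max _ _).trans (max_le h1 h2)

/-- The integral is bounded by the essential supremum. -/
theorem norm_simpleIntegral_le [IsUltrametricDist H] (hP : IsProjectionMeasure L P)
    {M : ℝ} (hM : ∀ A ∈ L, ‖P A‖ ≤ M) {n : ℕ} {c : Fin n → K} {B : Fin n → Set X}
    (hB : ∀ i, B i ∈ L) {r : ℝ} (hr : 0 ≤ r)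
    (h : EssBoundedBy L P (simpleFunction c B) r) : ‖simpleIntegral P c B‖ ≤ r * M := by
  obtain ⟨N, hN, hN0, h⟩ := h
  refine ContinuousLinearMap.opNorm_le_bound _ (mul_nonneg hr (hP.bound_nonneg hM)) fun ξ => ?_
  have := hP.norm_const_add_simpleIntegral_le hM hN hN0 hr n c B hB 0 _
    hP.isSetAlgebra.univ_mem (fun t _ ht => by simpa using h t ht) ξ
  simpa [hP.map_univ] using this

end IsProjectionMeasure

theorem EssBoundedBy.mono {f g : X → K} {r s : ℝ} (h : EssBoundedBy L P f r)
    (hfg : ∀ t, ‖f t‖ ≤ r → ‖g t‖ ≤ s) : EssBoundedBy L P g s := by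
  obtain ⟨N, hN, hN0, h⟩ := h
  exact ⟨N, hN, hN0, fun t ht => hfg t (h t ht)⟩

theorem EssBoundedBy.mono₂ {f g k : X → K} {r s q : ℝ} (hP : IsProjectionMeasure L P)
    (hf : EssBoundedBy L P f r) (hg : EssBoundedBy L P g s)
    (hk : ∀ t, ‖f t‖ ≤ r → ‖g t‖ ≤ s → ‖k t‖ ≤ q) : EssBoundedBy L P k q := by
  obtain ⟨N, hN, hN0, h⟩ := hf
  obtain ⟨N', hN', hN0', h'⟩ := hg
  refine ⟨N ∪ N', hP.isSetAlgebra.union_mem hN hN', hP.union_eq_zero hN hN' hN0 hN0',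
    fun t ht => hk t (h t fun h => ht (Or.inl h)) (h' t fun h => ht (Or.inr h))⟩

theorem essBoundedBy_of_forall (hP : IsProjectionMeasure L P) {f : X → K} {r : ℝ}
    (h : ∀ t, ‖f t‖ ≤ r) : EssBoundedBy L P f r :=
  ⟨∅, hP.isSetAlgebra.empty_mem, hP.map_empty, fun t _ => h t⟩

/-- The graph of integration on simple functions: the span of the pairs `(Ch_B, P B)`. That this
linear relation is the graph of a function (up to null sets) is the content of
`norm_le_of_mem_simpleGraph`. -/
def simpleGraph (L : Set (Set X)) (P : Set X → (H →L[K] H)) :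
    Submodule K ((X → K) × (H →L[K] H)) :=
  Submodule.span K {p | ∃ B ∈ L, p = (B.indicator (fun _ => 1), P B)}

theorem mem_simpleGraph_iff {s : X → K} {E : H →L[K] H} :
    (s, E) ∈ simpleGraph L P ↔ ∃ (n : ℕ) (c : Fin n → K) (B : Fin n → Set X),
      (∀ i, B i ∈ L) ∧ simpleFunction c B = s ∧ simpleIntegral P c B = E := by
  have aux : ∀ {n : ℕ} (c : Fin n → K) (B : Fin n → Set X),
      ∑ i, c i • (((B i).indicator (fun _ => (1 : K)), P (B i)) : (X → K) × (H →L[K] H)) =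
        (simpleFunction c B, simpleIntegral P c B) := by
    intro n c B
    refine Prod.ext ?_ ?_
    · ext t
      simp only [Prod.fst_sum, Prod.smul_fst, Finset.sum_apply, Pi.smul_apply, simpleFunction]
      refine Finset.sum_congr rfl fun i _ => ?_
      by_cases h : t ∈ B i <;> simp [h]
    · simp [Prod.snd_sum, simpleIntegral]
  constructor
  · intro h
    obtain ⟨n, c, g, hg⟩ := Submodule.mem_span_set'.1 h
    choose B hB hgB using fun i => (g i).2
    refine ⟨n, c, B, hB, ?_⟩
    have := aux c B
    simp only [← hgB, hg] at this
    exact ⟨(congrArg Prod.fst this).symm, (congrArg Prod.snd this).symm⟩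
  · rintro ⟨n, c, B, hB, rfl, rfl⟩
    rw [← aux]
    exact Submodule.sum_mem _ fun i _ => Submodule.smul_mem _ _
      (Submodule.subset_span ⟨_, hB i, rfl⟩)

theorem hasSpectralIntegral_iff {f : X → K} {E : H →L[K] H} :
    HasSpectralIntegral L P f E ↔ ∀ ε > (0 : ℝ), ∃ (s : X → K) (E' : H →L[K] H),
      (s, E') ∈ simpleGraph L P ∧ EssBoundedBy L P (fun t => f t - s t) ε ∧ ‖E - E'‖ ≤ ε := by
  refine forall₂_congr fun ε _ => ?_
  constructor
  · rintro ⟨n, c, B, hB, h1, h2⟩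
    exact ⟨_, _, mem_simpleGraph_iff.2 ⟨n, c, B, hB, rfl, rfl⟩, h1, h2⟩
  · rintro ⟨s, E', hs, h1, h2⟩
    obtain ⟨n, c, B, hB, rfl, rfl⟩ := mem_simpleGraph_iff.1 hs
    exact ⟨n, c, B, hB, h1, h2⟩

theorem mul_mem_simpleGraph (hP : IsProjectionMeasure L P) {p q : (X → K) × (H →L[K] H)}
    (hp : p ∈ simpleGraph L P) (hq : q ∈ simpleGraph L P) : p * q ∈ simpleGraph L P := by
  have h := Submodule.mul_mem_mul hp hq
  rw [simpleGraph, Submodule.span_mul_span] at h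
  refine Submodule.span_le.2 ?_ h
  rintro _ ⟨_, ⟨A, hA, rfl⟩, _, ⟨B, hB, rfl⟩, rfl⟩
  refine Submodule.subset_span ⟨A ∩ B, hP.isSetAlgebra.inter_mem hA hB, ?_⟩
  refine Prod.ext ?_ (hP.map_inter hA hB).symm
  ext t
  by_cases h1 : t ∈ A <;> by_cases h2 : t ∈ B <;> simp [h1, h2]

theorem norm_le_of_mem_simpleGraph [IsUltrametricDist H] (hP : IsProjectionMeasure L P) {M : ℝ}
    (hM : ∀ A ∈ L, ‖P A‖ ≤ M) {s : X → K} {E : H →L[K] H} (h : (s, E) ∈ simpleGraph L P) {r : ℝ}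
    (hr : 0 ≤ r) (hs : EssBoundedBy L P s r) : ‖E‖ ≤ r * M := by
  obtain ⟨n, c, B, hB, rfl, rfl⟩ := mem_simpleGraph_iff.1 h
  exact hP.norm_simpleIntegral_le hM hB hr hs

namespace HasSpectralIntegral

variable {f g : X → K} {E F : H →L[K] H}

theorem of_mem_simpleGraph (hP : IsProjectionMeasure L P) (h : (f, E) ∈ simpleGraph L P) :
    HasSpectralIntegral L P f E :=
  hasSpectralIntegral_iff.2 fun ε hε => ⟨f, E, h, essBoundedBy_of_forall hP (by simp [hε.le]),
    by simp [hε.le]⟩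

theorem norm_le [IsUltrametricDist H] (hP : IsProjectionMeasure L P) {M : ℝ} (hM : ∀ A ∈ L, ‖P A‖ ≤ M)
    (h : HasSpectralIntegral L P f E) {r : ℝ} (hr : 0 ≤ r) (hf : EssBoundedBy L P f r) :
    ‖E‖ ≤ r * M := by
  have hM0 := hP.bound_nonneg hM
  refine le_of_forall_pos_le_add fun δ hδ => ?_
  obtain ⟨s, E', hs, h1, h2⟩ := hasSpectralIntegral_iff.1 h (δ / (M + 1)) (by positivity)
  have hb : ‖E'‖ ≤ (r + δ / (M + 1)) * M := by
    refine norm_le_of_mem_simpleGraph hP hM hs (by positivity) (hf.mono₂ hP h1 fun t ha hb => ?_)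
    calc ‖s t‖ = ‖f t - (f t - s t)‖ := by rw [sub_sub_cancel]
      _ ≤ _ := (norm_sub_le _ _).trans (add_le_add ha hb)
  calc ‖E‖ = ‖E' + (E - E')‖ := by rw [add_sub_cancel]
    _ ≤ (r + δ / (M + 1)) * M + δ / (M + 1) := (norm_add_le _ _).trans (add_le_add hb h2)
    _ = r * M + δ := by field_simp; ring

theorem add (hP : IsProjectionMeasure L P) (hf : HasSpectralIntegral L P f E)
    (hg : HasSpectralIntegral L P g F) :
    HasSpectralIntegral L P (fun t => f t + g t) (E + F) := by
  refine hasSpectralIntegral_iff.2 fun ε hε => ?_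
  obtain ⟨s, E', hs, h1, h2⟩ := hasSpectralIntegral_iff.1 hf (ε / 2) (by positivity)
  obtain ⟨s', F', hs', h1', h2'⟩ := hasSpectralIntegral_iff.1 hg (ε / 2) (by positivity)
  refine ⟨_, _, Submodule.add_mem _ hs hs', h1.mono₂ hP h1' fun t ha hb => ?_, ?_⟩
  · rw [Pi.add_apply, add_sub_add_comm]
    exact (norm_add_le_of_le ha hb).trans_eq (add_halves ε)
  · rw [add_sub_add_comm]
    exact (norm_add_le_of_le h2 h2').trans_eq (add_halves ε)

theorem smul (k : K) (hf : HasSpectralIntegral L P f E) :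
    HasSpectralIntegral L P (fun t => k * f t) (k • E) := by
  refine hasSpectralIntegral_iff.2 fun ε hε => ?_
  have hk : ‖k‖ * (ε / (‖k‖ + 1)) ≤ ε := by
    rw [mul_div_assoc', div_le_iff₀ (by positivity)]
    nlinarith [norm_nonneg k]
  obtain ⟨s, E', hs, h1, h2⟩ := hasSpectralIntegral_iff.1 hf (ε / (‖k‖ + 1)) (by positivity)
  refine ⟨_, _, Submodule.smul_mem _ k hs, h1.mono fun t ha => ?_, ?_⟩
  · rw [Pi.smul_apply, smul_eq_mul, ← mul_sub, norm_mul]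
    exact (mul_le_mul_of_nonneg_left ha (norm_nonneg _)).trans hk
  · rw [← smul_sub, norm_smul]
    exact (mul_le_mul_of_nonneg_left h2 (norm_nonneg _)).trans hk

theorem sub (hP : IsProjectionMeasure L P) (hf : HasSpectralIntegral L P f E)
    (hg : HasSpectralIntegral L P g F) :
    HasSpectralIntegral L P (fun t => f t - g t) (E - F) := by
  have := hf.add hP (hg.smul (-1))
  simpa [sub_eq_add_neg] using this

/-- The spectral integral is unique. -/
theorem unique [IsUltrametricDist H] (hP : IsProjectionMeasure L P) (h : HasSpectralIntegral L P f E)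
    (h' : HasSpectralIntegral L P f F) : E = F := by
  obtain ⟨M, hM⟩ := hP.bounded
  have := (h.sub hP h').norm_le hP hM le_rfl (essBoundedBy_of_forall hP (by simp))
  rw [zero_mul] at this
  exact sub_eq_zero.1 (norm_le_zero_iff.1 this)

/-- The spectral integral is multiplicative on bounded functions. -/
theorem mul [IsUltrametricDist H] (hP : IsProjectionMeasure L P) (hf : HasSpectralIntegral L P f E)
    (hg : HasSpectralIntegral L P g F) {R : ℝ} (hR : 0 ≤ R) (hfR : ∀ t, ‖f t‖ ≤ R)
    (hgR : ∀ t, ‖g t‖ ≤ R) :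
    HasSpectralIntegral L P (fun t => f t * g t) (E * F) := by
  obtain ⟨M, hM⟩ := hP.bounded
  have hM0 := hP.bound_nonneg hM
  refine hasSpectralIntegral_iff.2 fun ε hε => ?_
  -- one bound `Q` serves for the functions, their approximations, and the integrals
  set Q : ℝ := (R + 1) * (M + 1) with hQ
  have hQ1 : R + 1 ≤ Q := by nlinarith
  have hQ0 : 0 < Q := by linarith
  set δ : ℝ := min 1 (ε / (2 * Q)) with hδ
  have hδ0 : 0 < δ := lt_min one_pos (by positivity)
  have hδ1 : δ ≤ 1 := min_le_left _ _
  have hδε : Q * δ + δ * Q ≤ ε := by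
    have := min_le_right (1 : ℝ) (ε / (2 * Q))
    rw [← hδ, le_div_iff₀ (by positivity)] at this
    linarith
  obtain ⟨s, E', hs, h1, h2⟩ := hasSpectralIntegral_iff.1 hf δ hδ0
  obtain ⟨s', F', hs', h1', h2'⟩ := hasSpectralIntegral_iff.1 hg δ hδ0
  have hs'R : ∀ t, ‖g t - s' t‖ ≤ δ → ‖s' t‖ ≤ R + 1 := fun t ht => by
    calc ‖s' t‖ = ‖g t - (g t - s' t)‖ := by rw [sub_sub_cancel]
      _ ≤ R + δ := norm_sub_le_of_le (hgR t) ht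
      _ ≤ R + 1 := by linarith
  have hE : ‖E‖ ≤ Q := (hf.norm_le hP hM hR (essBoundedBy_of_forall hP hfR)).trans (by nlinarith)
  have hF' : ‖F'‖ ≤ Q :=
    (norm_le_of_mem_simpleGraph hP hM hs' (by positivity) (h1'.mono hs'R)).trans (by nlinarith)
  refine ⟨_, _, mul_mem_simpleGraph hP hs hs', h1.mono₂ hP h1' fun t ha hb => ?_, ?_⟩
  · have : f t * g t - (s * s') t = f t * (g t - s' t) + (f t - s t) * s' t := by
      simp only [Pi.mul_apply]; ring
    rw [this]
    refine (norm_add_le_of_le (norm_mul_le_of_le ((hfR t).trans (by linarith)) hb)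
      (norm_mul_le_of_le ha ((hs'R t hb).trans hQ1))).trans hδε
  · have : E * F - E' * F' = E * (F - F') + (E - E') * F' := by noncomm_ring
    rw [this]
    exact (norm_add_le_of_le (norm_mul_le_of_le hE h2') (norm_mul_le_of_le h2 hF')).trans hδε

/-- A uniform limit of simple functions has a spectral integral, as `H →L[K] H` is complete. -/
theorem exists_of_forall_approx [IsUltrametricDist H] [CompleteSpace H] (hP : IsProjectionMeasure L P)
    (h : ∀ ε > (0 : ℝ), ∃ (s : X → K) (E' : H →L[K] H),
      (s, E') ∈ simpleGraph L P ∧ ∀ t, ‖f t - s t‖ ≤ ε) :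
    ∃ E, HasSpectralIntegral L P f E := by
  obtain ⟨M, hM⟩ := hP.bounded
  have hM0 := hP.bound_nonneg hM
  have hpos : ∀ n : ℕ, (0 : ℝ) < 1 / (n + 1) := fun n => by positivity
  choose s E' hs hf using fun n : ℕ => h (1 / (n + 1)) (hpos n)
  have hdist : ∀ m n N : ℕ, N ≤ m → N ≤ n → dist (E' m) (E' n) ≤ 2 * (1 / ((N : ℝ) + 1)) * M := by
    intro m n N hm hn
    rw [dist_eq_norm]
    refine norm_le_of_mem_simpleGraph hP hM (Submodule.sub_mem _ (hs m) (hs n)) (by positivity)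
      (essBoundedBy_of_forall hP fun t => ?_)
    have : (s m - s n) t = (f t - s n t) - (f t - s m t) := by simp
    change ‖(s m - s n) t‖ ≤ _
    rw [this, two_mul]
    refine norm_sub_le_of_le ((hf n t).trans ?_) ((hf m t).trans ?_)
    · exact Nat.one_div_le_one_div hn
    · exact Nat.one_div_le_one_div hm
  have hlim : Filter.Tendsto (fun N : ℕ => 2 * (1 / ((N : ℝ) + 1)) * M) Filter.atTop (nhds 0) := by
    simpa using (tendsto_one_div_add_atTop_nhds_zero_nat.const_mul (2 : ℝ)).mul_const M
  obtain ⟨E, hE⟩ := cauchySeq_tendsto_of_complete (cauchySeq_of_le_tendsto_0 _ hdist hlim)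
  refine ⟨E, hasSpectralIntegral_iff.2 fun ε hε => ?_⟩
  have e1 : ∀ᶠ n in Filter.atTop, ‖E - E' n‖ ≤ ε := by
    filter_upwards [hE.eventually (Metric.ball_mem_nhds E hε)] with n hn
    rw [← dist_eq_norm, dist_comm]
    exact (Metric.mem_ball.1 hn).le
  have e2 : ∀ᶠ n : ℕ in Filter.atTop, 1 / ((n : ℝ) + 1) ≤ ε :=
    (tendsto_one_div_add_atTop_nhds_zero_nat.eventually_lt_const hε).mono fun _ h => h.le
  obtain ⟨n, h1, h2⟩ := (e1.and e2).exists
  exact ⟨s n, E' n, hs n, essBoundedBy_of_forall hP fun t => (hf n t).trans h2, h1⟩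

end HasSpectralIntegral

end Integration

/-! ### Regular tight projection-valued measures -/

section Regular

open TopologicalSpace

variable {K : Type u} [NontriviallyNormedField K]
variable {X : Type v} [TopologicalSpace X]
variable {H : Type x} [NormedAddCommGroup H] [NormedSpace K H]
variable {L L' : Set (Set X)} {P P' : Set X → (H →L[K] H)}

namespace IsRegularTight

/-- Inner approximation: in the strong operator topology, `P V` is a limit of the values of `P` on
the compact subsets of `V`. -/
theorem exists_compact_subset_norm_sub_lt (hP : IsRegularTight L P) {V : Set X} (hV : V ∈ L)
    (ξ : H) {ε : ℝ} (hε : 0 < ε) :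
    ∃ C ∈ L, IsCompact C ∧ C ⊆ V ∧ ‖P V ξ - P C ξ‖ < ε := by
  obtain ⟨M, hM⟩ := hP.bounded
  have hM0 := hP.bound_nonneg hM
  -- the vectors fixed by some `P C` form a submodule, as the union of two compact sets is compact
  let D : Submodule K H :=
    { carrier := {η | ∃ C ∈ L, IsCompact C ∧ C ⊆ V ∧ P C η = η}
      zero_mem' := ⟨∅, hP.isSetAlgebra.empty_mem, isCompact_empty, Set.empty_subset _, by simp⟩
      smul_mem' := by
        rintro c η ⟨C, hC, hCc, hCV, h⟩
        exact ⟨C, hC, hCc, hCV, by rw [map_smul, h]⟩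
      add_mem' := by
        rintro η η' ⟨C, hC, hCc, hCV, h⟩ ⟨C', hC', hCc', hCV', h'⟩
        have hU := hP.isSetAlgebra.union_mem hC hC'
        refine ⟨C ∪ C', hU, hCc.union hCc', Set.union_subset hCV hCV', ?_⟩
        rw [map_add, ← h, ← h', ← mul_apply_eq_comp, ← mul_apply_eq_comp,
          hP.mul_of_superset hC hU Set.subset_union_left,
          hP.mul_of_superset hC' hU Set.subset_union_right] }
  have hD : (⨆ C ∈ {C : Set X | C ∈ L ∧ IsCompact C ∧ C ⊆ V},
      LinearMap.range (P C : H →ₗ[K] H)) ≤ D :=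
    iSup₂_le fun C hC η hη =>
      ⟨C, hC.1, hC.2.1, hC.2.2, hP.apply_eq_self_of_mem_range hC.1 hη⟩
  have hmem : P V ξ ∈ D.topologicalClosure := by
    refine Submodule.topologicalClosure_mono hD ?_
    rw [← hP.regular V hV]
    exact ⟨ξ, rfl⟩
  obtain ⟨η, ⟨C, hC, hCc, hCV, hη⟩, hdist⟩ :=
    Metric.mem_closure_iff.1 hmem (ε / (M + 1)) (by positivity)
  refine ⟨C, hC, hCc, hCV, ?_⟩
  rw [dist_eq_norm] at hdist
  have h1 : P V ξ - P C ξ = (P V ξ - η) - P C (P V ξ - η) := by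
    rw [map_sub, hη, ← mul_apply_eq_comp, hP.mul_of_subset hC hV hCV]
    abel
  have h2 : ‖P C (P V ξ - η)‖ ≤ M * ‖P V ξ - η‖ := (P C).le_of_opNorm_le (hM C hC) _
  rw [lt_div_iff₀ (by positivity)] at hdist
  calc ‖P V ξ - P C ξ‖ ≤ ‖P V ξ - η‖ + M * ‖P V ξ - η‖ := by
        rw [h1]; exact norm_sub_le_of_le le_rfl h2
    _ < ε := by linarith

variable [T2Space X]

theorem compactOpen_mem (hP : IsRegularTight L P) (U : CompactOpens X) : (U : Set X) ∈ L :=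
  hP.clopen_mem _ (isClopen_compactOpen U)

theorem hasSpectralIntegral_char (hP : IsRegularTight L P) (U : CompactOpens X) :
    HasSpectralIntegral L P (compactOpenChar (K := K) U) (P U) :=
  .of_mem_simpleGraph hP.toIsProjectionMeasure
    (Submodule.subset_span ⟨U, hP.compactOpen_mem U, rfl⟩)

theorem exists_hasSpectralIntegral [IsUltrametricDist K] [IsUltrametricDist H] [CompleteSpace H]
    (hP : IsRegularTight L P) (f : C₀(X, K)) : ∃ E, HasSpectralIntegral L P f E := by
  refine HasSpectralIntegral.exists_of_forall_approx hP.toIsProjectionMeasure fun ε hε => ?_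
  obtain ⟨s, hs, hfs⟩ := exists_mem_span_char_norm_sub_le f hε
  have : ∃ E' : H →L[K] H, ((s : X → K), E') ∈ simpleGraph L P := by
    clear hfs
    induction hs using Submodule.span_induction with
    | mem g hg =>
      obtain ⟨U, rfl⟩ := hg
      exact ⟨P U, Submodule.subset_span ⟨U, hP.compactOpen_mem U, rfl⟩⟩
    | zero => exact ⟨0, Submodule.zero_mem _⟩
    | add g g' _ _ h h' =>
      obtain ⟨E, hE⟩ := h
      obtain ⟨E', hE'⟩ := h'
      exact ⟨E + E', Submodule.add_mem _ hE hE'⟩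
    | smul c g _ h =>
      obtain ⟨E, hE⟩ := h
      exact ⟨c • E, Submodule.smul_mem _ c hE⟩
  obtain ⟨E', hE'⟩ := this
  exact ⟨s, E', hE', fun t => (norm_apply_le (f - s) t).trans hfs⟩

variable [LocallyCompactSpace X] [TotallyDisconnectedSpace X]

/-- Outer approximation: in the strong operator topology, the value at a compact set `C` is a limit
of the values at the compact open sets containing `C`, because the differences `U \ C` shrink to the
empty set. -/
theorem exists_compactOpen_superset_norm_sub_lt (hP : IsRegularTight L P) {C : Set X}
    (hC : C ∈ L) (hCc : IsCompact C) (ξ : H) {ε : ℝ} (hε : 0 < ε) :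
    ∃ U : CompactOpens X, C ⊆ U ∧ ‖P U ξ - P C ξ‖ < ε := by
  let S : Set (Set X) := {A | ∃ U : CompactOpens X, C ⊆ U ∧ A = (U : Set X) \ C}
  obtain ⟨U₀, hU₀, -⟩ := exists_compactOpen_between hCc isOpen_univ (Set.subset_univ C)
  have hSL : S ⊆ L := by
    rintro _ ⟨U, -, rfl⟩
    exact hP.isSetAlgebra.sdiff_mem (hP.compactOpen_mem U) hC
  have hdir : DirectedOn (fun A B => B ⊆ A) S := by
    rintro _ ⟨U, hU, rfl⟩ _ ⟨U', hU', rfl⟩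
    refine ⟨_, ⟨compactOpenInter U U' (isClopen_compactOpen U'), Set.subset_inter hU hU', rfl⟩,
      Set.sdiff_subset_sdiff_left Set.inter_subset_left,
      Set.sdiff_subset_sdiff_left Set.inter_subset_right⟩
  have hinter : ⋂₀ S = ∅ := by
    refine Set.eq_empty_of_forall_notMem fun t ht => ?_
    have htC : t ∉ C := (ht _ ⟨U₀, hU₀, rfl⟩).2
    obtain ⟨U, hU, hUt⟩ := exists_compactOpen_between hCc (isOpen_compl_singleton (x := t))
      (by simpa using htC)
    exact hUt (ht _ ⟨U, hU, rfl⟩).1 rfl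
  obtain ⟨A, ⟨U, hU, rfl⟩, hA⟩ := hP.tendsto_zero S hSL ⟨_, U₀, hU₀, rfl⟩ hdir hinter ξ ε hε
  refine ⟨U, hU, ?_⟩
  have := hA _ ⟨U, hU, rfl⟩ subset_rfl
  have h2 := hP.map_inter_add_map_sdiff (hP.compactOpen_mem U) hC
  rw [Set.inter_eq_right.2 hU] at h2
  rwa [← h2, add_apply, add_sub_cancel_left]

/-- A bound for the values on compact open sets is a bound for all values. -/
theorem norm_le_of_forall_compactOpen [IsUltrametricDist H] (hP : IsRegularTight L P) {M : ℝ}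
    (hM0 : 0 ≤ M) (hM : ∀ U : CompactOpens X, ‖P U‖ ≤ M) {V : Set X} (hV : V ∈ L) :
    ‖P V‖ ≤ M := by
  refine ContinuousLinearMap.opNorm_le_bound _ hM0 fun ξ => ?_
  refine le_of_forall_pos_le_add fun ε hε => ?_
  obtain ⟨C, hC, hCc, -, h1⟩ := hP.exists_compact_subset_norm_sub_lt hV ξ (half_pos hε)
  obtain ⟨U, -, h2⟩ := hP.exists_compactOpen_superset_norm_sub_lt hC hCc ξ (half_pos hε)
  have h3 : ‖P U ξ‖ ≤ M * ‖ξ‖ := (P U).le_of_opNorm_le (hM U) ξ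
  have h4 : P V ξ = P U ξ + ((P V ξ - P C ξ) - (P U ξ - P C ξ)) := by abel
  calc ‖P V ξ‖ ≤ M * ‖ξ‖ + (ε / 2 + ε / 2) := by
        rw [h4]; exact norm_add_le_of_le h3 (norm_sub_le_of_le h1.le h2.le)
    _ = M * ‖ξ‖ + ε := by ring

/-- Disjoint compact sets are separated by a compact open set. Hence for measures that agree on the
compact open sets, the values at disjoint sets are orthogonal, first for compact sets and then, by
inner approximation, in general. -/
theorem mul_eq_zero_of_disjoint (hP : IsRegularTight L P) (hP' : IsRegularTight L' P')
    (h : ∀ U : CompactOpens X, P U = P' U) {V W : Set X} (hV : V ∈ L) (hW : W ∈ L')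
    (hVW : Disjoint V W) : P V * P' W = 0 := by
  have hcompact : ∀ C ∈ L, ∀ C' ∈ L', IsCompact C → IsCompact C' → Disjoint C C' →
      P C * P' C' = 0 := by
    intro C hC C' hC' hCc hCc' hd
    obtain ⟨U, hCU, hUC'⟩ := exists_compactOpen_between hCc hCc'.isClosed.isOpen_compl
      (Set.disjoint_left.1 hd)
    have hd' : Disjoint (U : Set X) C' := Set.disjoint_left.2 fun _ ht => hUC' ht
    rw [← hP.mul_of_subset hC (hP.compactOpen_mem U) hCU, mul_assoc, h,
      hP'.mul_of_disjoint _ (hP'.compactOpen_mem U) _ hC' hd', mul_zero]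
  have hleft : ∀ C ∈ L, IsCompact C → C ⊆ V → P C * P' W = 0 := by
    intro C hC hCc hCV
    ext ξ
    refine norm_le_zero_iff.1 (le_of_forall_pos_le_add fun ε hε => ?_)
    obtain ⟨C', hC', hCc', hCW', h1⟩ :=
      hP'.exists_compact_subset_norm_sub_lt hW ξ (ε := ε / (‖P C‖ + 1)) (by positivity)
    have h0 : P C (P' C' ξ) = 0 := by
      rw [← mul_apply_eq_comp, hcompact C hC C' hC' hCc hCc' (hVW.mono hCV hCW'), zero_apply]
    rw [lt_div_iff₀ (by positivity)] at h1
    calc ‖(P C * P' W) ξ‖ = ‖P C (P' W ξ - P' C' ξ)‖ := by rw [map_sub, h0, sub_zero]; rfl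
      _ ≤ ‖P C‖ * ‖P' W ξ - P' C' ξ‖ := (P C).le_opNorm _
      _ ≤ 0 + ε := by nlinarith [norm_nonneg (P' W ξ - P' C' ξ)]
  ext ξ
  refine norm_le_zero_iff.1 (le_of_forall_pos_le_add fun ε hε => ?_)
  obtain ⟨C, hC, hCc, hCV, h1⟩ := hP.exists_compact_subset_norm_sub_lt hV (P' W ξ) hε
  have h0 : P C (P' W ξ) = 0 := by rw [← mul_apply_eq_comp, hleft C hC hCc hCV, zero_apply]
  rw [h0, sub_zero] at h1
  simpa using h1.le

/-- Regular tight measures that agree on the compact open sets agree wherever both are defined. -/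
theorem eq_of_forall_compactOpen (hP : IsRegularTight L P) (hP' : IsRegularTight L' P')
    (h : ∀ U : CompactOpens X, P U = P' U) {V : Set X} (hV : V ∈ L) (hV' : V ∈ L') :
    P V = P' V := by
  have h1 := hP.mul_eq_zero_of_disjoint hP' h hV (hP'.isSetAlgebra.compl_mem hV')
    disjoint_compl_right
  have h2 := hP.mul_eq_zero_of_disjoint hP' h (hP.isSetAlgebra.compl_mem hV) hV'
    disjoint_compl_left
  rw [hP'.map_compl hV', mul_sub, mul_one, sub_eq_zero] at h1
  rw [hP.map_compl hV, sub_mul, one_mul, sub_eq_zero] at h2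
  rw [h1, ← h2]

/-- For a regular measure, the ranges of the values on compact open sets span a dense subspace. -/
theorem closure_iSup_range_compactOpen (hP : IsRegularTight L P) :
    (⨆ U : CompactOpens X, LinearMap.range (P U : H →ₗ[K] H)).topologicalClosure = ⊤ := by
  have huniv : LinearMap.range (P Set.univ : H →ₗ[K] H) = ⊤ := by
    rw [hP.map_univ]
    exact LinearMap.range_id
  rw [eq_top_iff, ← huniv, hP.regular _ hP.isSetAlgebra.univ_mem]
  refine Submodule.topologicalClosure_mono (iSup₂_le fun C hC => ?_)
  obtain ⟨U, hU, -⟩ := exists_compactOpen_between hC.2.1 isOpen_univ (Set.subset_univ C)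
  refine le_trans ?_ (le_iSup _ U)
  rintro _ ⟨ξ, rfl⟩
  exact ⟨P C ξ, congrArg (fun E : H →L[K] H => E ξ)
    (hP.mul_of_superset hC.1 (hP.compactOpen_mem U) hU)⟩

end IsRegularTight

end Regular

/-! ### From measures to representations -/

section MeasureToRep

open TopologicalSpace

variable {K : Type u} [NontriviallyNormedField K] [IsUltrametricDist K]
variable {X : Type w} [TopologicalSpace X] [T2Space X] [LocallyCompactSpace X]
  [TotallyDisconnectedSpace X]
variable {A : Type v} [NonUnitalNormedCommRing A] [NormedSpace K A]
variable {H : Type x} [NormedAddCommGroup H] [NormedSpace K H] [IsUltrametricDist H]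
variable {L : Set (Set X)} {P : Set X → (H →L[K] H)}

omit [IsUltrametricDist K] [T2Space X] [LocallyCompactSpace X] [TotallyDisconnectedSpace X] in
theorem HasSpectralIntegral.norm_le_of_isometry (hP : IsProjectionMeasure L P) {M : ℝ}
    (hM : ∀ V ∈ L, ‖P V‖ ≤ M) {Γ : A →ₙₐ[K] C₀(X, K)} (hΓ : Isometry Γ) {a : A} {E : H →L[K] H}
    (h : HasSpectralIntegral L P (Γ a) E) : ‖E‖ ≤ ‖a‖ * M := by
  refine h.norm_le hP hM (norm_nonneg a) (essBoundedBy_of_forall hP fun t => ?_)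
  rw [← hΓ.norm_map_of_map_zero (map_zero Γ)]
  exact norm_apply_le (Γ a) t

/-- Spectral integration against a regular tight measure is a non-degenerate representation. -/
theorem IsRegularTight.exists_rep [CompleteSpace H] (hP : IsRegularTight L P)
    {Γ : A →ₙₐ[K] C₀(X, K)} (hΓ : Isometry Γ) (hsurj : Function.Surjective Γ) :
    ∃ T : A →ₙₐ[K] (H →L[K] H), IsNondegenerateRep T ∧
      ∀ (a : A) (E : H →L[K] H), HasSpectralIntegral L P (Γ a) E ↔ E = T a := by
  have hP' := hP.toIsProjectionMeasure
  choose T hT using fun a => hP.exists_hasSpectralIntegral (Γ a)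
  have huniq : ∀ {a E}, HasSpectralIntegral L P (Γ a) E → E = T a := fun h => h.unique hP' (hT _)
  have hadd : ∀ a b, T (a + b) = T a + T b := fun a b => by
    refine (huniq ?_).symm
    rw [map_add]
    exact (hT a).add hP' (hT b)
  have hsmul : ∀ (c : K) a, T (c • a) = c • T a := fun c a => by
    refine (huniq ?_).symm
    rw [map_smul]
    exact (hT a).smul c
  have hmul : ∀ a b, T (a * b) = T a * T b := fun a b => by
    refine (huniq ?_).symm
    rw [map_mul]
    exact (hT a).mul hP' (hT b) (R := max ‖Γ a‖ ‖Γ b‖) ((norm_nonneg _).trans (le_max_left _ _))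
      (fun t => (norm_apply_le _ t).trans (le_max_left _ _))
      (fun t => (norm_apply_le _ t).trans (le_max_right _ _))
  have hzero : T 0 = 0 := by simpa using hsmul 0 0
  let T' : A →ₙₐ[K] (H →L[K] H) :=
    { toFun := T
      map_smul' := hsmul
      map_zero' := hzero
      map_add' := hadd
      map_mul' := hmul }
  refine ⟨T', ⟨?_, ?_⟩, fun a E => ⟨huniq, ?_⟩⟩
  · obtain ⟨M, hM⟩ := hP.bounded
    refine AddMonoidHomClass.continuous_of_bound T' M fun a => ?_
    rw [mul_comm]
    exact (hT a).norm_le_of_isometry hP' hM hΓ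
  · rw [eq_top_iff, ← hP.closure_iSup_range_compactOpen]
    refine Submodule.topologicalClosure_mono (iSup_le fun U => ?_)
    rintro _ ⟨ξ, rfl⟩
    obtain ⟨a, ha⟩ := hsurj (compactOpenChar U)
    refine Submodule.subset_span ⟨a, ξ, congrArg (fun E : H →L[K] H => E ξ) (huniq ?_)⟩
    rw [ha]
    exact hP.hasSpectralIntegral_char U
  · rintro rfl
    exact hT a

end MeasureToRep

/-! ### From representations to measures -/

section RepToMeasure

open TopologicalSpace

variable {K : Type u} [NontriviallyNormedField K]
variable {H : Type x} [NormedAddCommGroup H] [NormedSpace K H]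

theorem IsNondegenerateRep.exists_bound {A : Type v} [NonUnitalNormedCommRing A] [NormedSpace K A]
    {T : A →ₙₐ[K] (H →L[K] H)} (hT : IsNondegenerateRep T) :
    ∃ M, 0 ≤ M ∧ ∀ a, ‖T a‖ ≤ M * ‖a‖ := by
  let T' : A →L[K] (H →L[K] H) :=
    { toFun := T
      map_add' := map_add T
      map_smul' := map_smul T
      cont := hT.continuous }
  exact ⟨‖T'‖, norm_nonneg _, T'.le_opNorm⟩

variable {X : Type w} [TopologicalSpace X] [T2Space X]
variable {T : C₀(X, K) →ₙₐ[K] (H →L[K] H)}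

theorem map_char_mul (U U' : CompactOpens X) :
    T (compactOpenChar U) * T (compactOpenChar U') =
      T (compactOpenChar (compactOpenInter U U' (isClopen_compactOpen U'))) := by
  rw [← map_mul]
  congr 1
  ext t
  by_cases h : t ∈ (U : Set X) <;> by_cases h' : t ∈ (U' : Set X) <;> simp [h, h']

theorem map_char_mul_of_subset {U U' : CompactOpens X} (h : (U' : Set X) ⊆ U) :
    T (compactOpenChar U) * T (compactOpenChar U') = T (compactOpenChar U') := by
  rw [map_char_mul]
  congr 2
  exact SetLike.coe_injective (Set.inter_eq_right.2 h)

/-- The characteristic functions of compact open sets act as an approximate unit: the vectors fixed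
by one of them are dense. -/
theorem IsNondegenerateRep.exists_char_fixed [IsUltrametricDist K] (hT : IsNondegenerateRep T)
    (ξ : H) {ε : ℝ} (hε : 0 < ε) :
    ∃ (U : CompactOpens X) (η : H), T (compactOpenChar U) η = η ∧ ‖ξ - η‖ < ε := by
  obtain ⟨M, hM0, hM⟩ := hT.exists_bound
  let D : Submodule K H :=
    { carrier := {η | ∃ U : CompactOpens X, T (compactOpenChar U) η = η}
      zero_mem' := ⟨⊥, by simp⟩
      smul_mem' := by
        rintro c η ⟨U, h⟩
        exact ⟨U, by rw [map_smul, h]⟩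
      add_mem' := by
        rintro η η' ⟨U, h⟩ ⟨U', h'⟩
        refine ⟨U ⊔ U', ?_⟩
        rw [map_add, ← h, ← h', ← mul_apply_eq_comp, ← mul_apply_eq_comp,
          map_char_mul_of_subset (by simp), map_char_mul_of_subset (by simp)] }
  have hspan : ∀ s ∈ Submodule.span K (Set.range (compactOpenChar (K := K) (X := X))),
      ∀ ζ, T s ζ ∈ D := by
    intro s hs ζ
    induction hs using Submodule.span_induction with
    | mem g hg =>
      obtain ⟨U, rfl⟩ := hg
      exact ⟨U, by rw [← mul_apply_eq_comp, map_char_mul_of_subset subset_rfl]⟩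
    | zero => simp
    | add g g' _ _ h h' =>
      rw [map_add, add_apply]
      exact D.add_mem h h'
    | smul c g _ h =>
      rw [map_smul, smul_apply]
      exact D.smul_mem c h
  have hle : Submodule.span K {η : H | ∃ (f : C₀(X, K)) (ζ : H), η = T f ζ} ≤
      D.topologicalClosure := by
    refine Submodule.span_le.2 ?_
    rintro _ ⟨f, ζ, rfl⟩
    refine Metric.mem_closure_iff.2 fun δ hδ => ?_
    obtain ⟨s, hs, hfs⟩ :=
      exists_mem_span_char_norm_sub_le f (ε := δ / (M * ‖ζ‖ + 1)) (by positivity)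
    refine ⟨_, hspan s hs ζ, ?_⟩
    rw [le_div_iff₀ (by positivity)] at hfs
    rcases (norm_nonneg (f - s)).eq_or_lt with h0 | h0
    · rw [dist_eq_norm, ← sub_apply, ← map_sub, norm_eq_zero.1 h0.symm]
      simpa using hδ
    · calc dist (T f ζ) (T s ζ) = ‖T (f - s) ζ‖ := by rw [dist_eq_norm, map_sub, sub_apply]
        _ ≤ M * ‖f - s‖ * ‖ζ‖ := (T (f - s)).le_of_opNorm_le (hM _) _
        _ < δ := by nlinarith
  have htop : ξ ∈ D.topologicalClosure := by
    have := Submodule.topologicalClosure_minimal _ hle D.isClosed_topologicalClosure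
    rw [hT.dense_span] at this
    exact this trivial
  obtain ⟨η, ⟨U, hU⟩, hη⟩ := Metric.mem_closure_iff.1 htop ε hε
  exact ⟨U, η, hU, by rwa [← dist_eq_norm]⟩

theorem IsNondegenerateRep.ext [IsUltrametricDist K] (hT : IsNondegenerateRep T) {E F : H →L[K] H}
    (h : ∀ U : CompactOpens X, E * T (compactOpenChar U) = F * T (compactOpenChar U)) : E = F := by
  have hd : Dense {η : H | ∃ U : CompactOpens X, T (compactOpenChar U) η = η} := fun ξ =>
    Metric.mem_closure_iff.2 fun ε hε => by
      obtain ⟨U, η, hU, hη⟩ := hT.exists_char_fixed ξ hε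
      exact ⟨η, ⟨U, hU⟩, by rwa [dist_eq_norm]⟩
  refine ContinuousLinearMap.coeFn_injective (Continuous.ext_on hd E.continuous F.continuous ?_)
  rintro η ⟨U, hU⟩
  rw [← hU]
  exact congrArg (fun E : H →L[K] H => E η) (h U)

/-- The value at the clopen set `V` of the measure of `T`: the strong limit of the operators
`T (Ch_(U ∩ V))` over the compact open sets `U`. -/
theorem IsNondegenerateRep.exists_clopen_operator [IsUltrametricDist K] [CompleteSpace H]
    (hT : IsNondegenerateRep T) {M : ℝ} (hM0 : 0 ≤ M) (hM : ∀ f, ‖T f‖ ≤ M * ‖f‖)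
    {V : Set X} (hV : IsClopen V) :
    ∃ E : H →L[K] H, ‖E‖ ≤ M ∧ ∀ U : CompactOpens X,
      E * T (compactOpenChar U) = T (compactOpenChar (compactOpenInter U V hV)) := by
  have hchar : ∀ U : CompactOpens X, ‖T (compactOpenChar U)‖ ≤ M := fun U =>
    (hM _).trans (mul_le_of_le_one_right hM0 (norm_compactOpenChar_le U))
  set F : CompactOpens X → (H →L[K] H) := fun U => T (compactOpenChar (compactOpenInter U V hV))
    with hF
  have hFmul : ∀ {U U' : CompactOpens X}, U ≤ U' → F U' * T (compactOpenChar U) = F U := by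
    intro U U' hU
    rw [hF, map_char_mul]
    congr 2
    refine SetLike.coe_injective ?_
    have : (U : Set X) ⊆ U' := hU
    simp only [coe_compactOpenInter]
    rw [Set.inter_right_comm, Set.inter_eq_right.2 this]
  have hlim : ∀ ξ, ∃ η, Filter.Tendsto (fun U => F U ξ) Filter.atTop (nhds η) := by
    intro ξ
    refine cauchySeq_tendsto_of_complete (Metric.cauchySeq_iff'.2 fun ε hε => ?_)
    obtain ⟨U, η, hU, hη⟩ := hT.exists_char_fixed ξ (ε := ε / (2 * M + 1)) (by positivity)
    rw [lt_div_iff₀ (by positivity)] at hη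
    refine ⟨U, fun U' hU' => ?_⟩
    have h1 : F U' η = F U η := by
      conv_lhs => rw [← hU]
      rw [← mul_apply_eq_comp, hFmul hU']
    have h2 : F U' ξ - F U ξ = F U' (ξ - η) - F U (ξ - η) := by
      rw [map_sub, map_sub, h1]; abel
    rw [dist_eq_norm, h2]
    calc ‖F U' (ξ - η) - F U (ξ - η)‖ ≤ M * ‖ξ - η‖ + M * ‖ξ - η‖ :=
          norm_sub_le_of_le ((F U').le_of_opNorm_le (hchar _) _)
            ((F U).le_of_opNorm_le (hchar _) _)
      _ < ε := by nlinarith [norm_nonneg (ξ - η)]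
  choose E hE using hlim
  let E' : H →ₗ[K] H := linearMapOfTendsto E (fun U => (F U : H →ₗ[K] H))
    (tendsto_pi_nhds.2 hE)
  have hE' : ∀ ξ, ‖E' ξ‖ ≤ M * ‖ξ‖ := fun ξ =>
    le_of_tendsto (hE ξ).norm (Filter.Eventually.of_forall fun U =>
      (F U).le_of_opNorm_le (hchar _) ξ)
  refine ⟨E'.mkContinuous M hE', E'.mkContinuous_norm_le hM0 hE', fun U => ?_⟩
  ext ξ
  refine tendsto_nhds_unique (hE (T (compactOpenChar U) ξ)) (tendsto_const_nhds.congr' ?_)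
  filter_upwards [Filter.eventually_ge_atTop U] with U' hU'
  rw [← mul_apply_eq_comp, hFmul hU']

/-- Every non-degenerate representation of `C₀(X, K)` is spectral integration against a regular
measure on the clopen sets. -/
theorem IsNondegenerateRep.exists_measure [IsUltrametricDist K] [CompleteSpace H]
    (hT : IsNondegenerateRep T) :
    ∃ P : Set X → (H →L[K] H), IsRegularTight {V : Set X | IsClopen V} P ∧
      ∀ f : C₀(X, K), HasSpectralIntegral {V : Set X | IsClopen V} P f (T f) := by
  classical
  obtain ⟨M, hM0, hM⟩ := hT.exists_bound
  choose Q hQM hQ using fun V : {V : Set X // IsClopen V} => hT.exists_clopen_operator hM0 hM V.2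
  let P : Set X → (H →L[K] H) := fun V => if h : IsClopen V then Q ⟨V, h⟩ else 0
  have hPM : ∀ V, IsClopen V → ‖P V‖ ≤ M := fun V hV => by
    simp only [P, dif_pos hV]; exact hQM _
  have hPU : ∀ {V} (hV : IsClopen V) (U : CompactOpens X), P V * T (compactOpenChar U) =
      T (compactOpenChar (compactOpenInter U V hV)) := fun hV U => by
    simp only [P, dif_pos hV]; exact hQ _ _
  have hinter : ∀ {V W}, IsClopen V → IsClopen W → P V * P W = P (V ∩ W) := @fun V W hV hW => by
    refine hT.ext fun U => ?_
    rw [mul_assoc, hPU hW, hPU hV, hPU (hV.inter hW)]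
    congr 2
    refine SetLike.coe_injective ?_
    simp only [coe_compactOpenInter]
    rw [Set.inter_assoc, Set.inter_comm _ V]
  have hempty : P ∅ = 0 := hT.ext fun U => by
    rw [hPU isClopen_empty, zero_mul, ← map_zero T]
    congr 1
    ext t
    simp
  have hchar : ∀ U : CompactOpens X, P U = T (compactOpenChar U) := fun U => hT.ext fun U' => by
    rw [hPU (isClopen_compactOpen U), map_char_mul]
    congr 2
    exact SetLike.coe_injective (Set.inter_comm _ _)
  have hsub : ∀ {V W}, IsClopen V → IsClopen W → V ⊆ W → P W * P V = P V := fun hV hW h => by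
    rw [hinter hW hV, Set.inter_eq_right.2 h]
  refine ⟨P, ⟨⟨⟨isClopen_empty, fun _ h => h.compl, fun _ _ h h' => h.union h'⟩, ?_, ?_, hempty,
    ?_, ?_, ⟨M, hPM⟩, ?_⟩, fun _ h => h, ?_⟩, ?_⟩
  · intro V hV
    rw [hinter hV hV, Set.inter_self]
  · refine hT.ext fun U => ?_
    rw [hPU isClopen_univ, one_mul]
    congr 2
    exact SetLike.coe_injective (Set.inter_univ _)
  · intro V hV W hW hVW
    rw [hinter hV hW, hVW.inter_eq, hempty]
  · intro V hV W hW hVW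
    refine hT.ext fun U => ?_
    rw [add_mul, hPU hV, hPU hW, hPU (hV.union hW), ← map_add]
    congr 1
    ext t
    by_cases h : t ∈ (U : Set X) <;> by_cases h1 : t ∈ V <;> by_cases h2 : t ∈ W <;>
      simp [h, h1, h2]
    exact Set.disjoint_left.1 hVW h1 h2
  · -- a vector fixed by `T (Ch_U)` is annihilated by `P V` as soon as `V` misses the compact set `U`
    intro S hS hne hdir hempty' ξ ε hε
    obtain ⟨U, η, hU, hη⟩ := hT.exists_char_fixed ξ (ε := ε / (M + 1)) (by positivity)
    rw [lt_div_iff₀ (by positivity)] at hη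
    have : Nonempty S := hne.to_subtype
    obtain ⟨⟨V₀, hV₀⟩, hUV⟩ := U.isCompact.elim_directed_family_closed (fun V : S => (V : Set X))
      (fun V => (hS V.2).isClosed)
      (by rw [← Set.sInter_eq_iInter, hempty', Set.inter_empty])
      (directedOn_iff_directed.1 hdir)
    refine ⟨V₀, hV₀, fun V hVS hVV₀ => ?_⟩
    have hV : IsClopen V := hS hVS
    have h0 : P V η = 0 := by
      rw [← hU, ← mul_apply_eq_comp, ← hchar, hinter hV (isClopen_compactOpen U),
        Set.eq_empty_of_subset_empty (s := V ∩ U), hempty, zero_apply]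
      rw [← hUV, Set.inter_comm]
      exact Set.inter_subset_inter_right _ hVV₀
    calc ‖P V ξ‖ = ‖P V (ξ - η)‖ := by rw [map_sub, h0, sub_zero]
      _ ≤ M * ‖ξ - η‖ := (P V).le_of_opNorm_le (hPM V hV) _
      _ < ε := by nlinarith [norm_nonneg (ξ - η)]
  · intro V hV
    apply le_antisymm
    · rintro _ ⟨ξ, rfl⟩
      refine Metric.mem_closure_iff.2 fun ε hε => ?_
      obtain ⟨U, η, hU, hη⟩ := hT.exists_char_fixed ξ (ε := ε / (M + 1)) (by positivity)
      rw [lt_div_iff₀ (by positivity)] at hη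
      set W := compactOpenInter U V hV
      refine ⟨P W η, ?_, ?_⟩
      · refine (le_iSup₂_of_le (f := fun C (_ : C ∈ {C : Set X | IsClopen C ∧ IsCompact C ∧ C ⊆ V})
          => LinearMap.range (P C : H →ₗ[K] H)) (W : Set X)
          ⟨isClopen_compactOpen W, W.isCompact, Set.inter_subset_right⟩ le_rfl) ⟨η, rfl⟩
      · have h0 : P W η = P V η := by
          conv_rhs => rw [← hU]
          rw [← mul_apply_eq_comp, hPU hV, hchar]
        calc dist (P V ξ) (P W η) = ‖P V (ξ - η)‖ := by rw [h0, dist_eq_norm, map_sub]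
          _ ≤ M * ‖ξ - η‖ := (P V).le_of_opNorm_le (hPM V hV) _
          _ < ε := by nlinarith [norm_nonneg (ξ - η)]
    · refine Submodule.topologicalClosure_minimal _ (iSup₂_le fun C hC => ?_) ?_
      · rintro _ ⟨ξ, rfl⟩
        exact ⟨P C ξ, congrArg (fun E : H →L[K] H => E ξ) (hsub hC.1 hV hC.2.2)⟩
      · -- the range of a continuous idempotent is its closed set of fixed points
        have : (LinearMap.range (P V : H →ₗ[K] H) : Set H) = {η | P V η = η} := by
          ext η
          constructor
          · rintro ⟨ξ, rfl⟩
            exact congrArg (fun E : H →L[K] H => E ξ) (hsub hV hV subset_rfl)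
          · exact fun h => ⟨η, h⟩
        rw [this]
        exact isClosed_eq (P V).continuous continuous_id
  · intro f
    refine hasSpectralIntegral_iff.2 fun ε hε => ?_
    obtain ⟨s, hs, hfs⟩ := exists_mem_span_char_norm_sub_le f (ε := ε / (M + 1)) (by positivity)
    have hle : ‖f - s‖ ≤ ε := hfs.trans (div_le_self hε.le (by linarith))
    refine ⟨s, T s, ?_, ⟨∅, isClopen_empty, hempty, fun t _ =>
      (norm_apply_le (f - s) t).trans hle⟩, ?_⟩
    · clear hfs hle
      induction hs using Submodule.span_induction with
      | mem g hg =>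
        obtain ⟨U, rfl⟩ := hg
        exact Submodule.subset_span ⟨U, isClopen_compactOpen U, by rw [hchar]; rfl⟩
      | zero =>
        rw [map_zero]
        exact Submodule.zero_mem _
      | add g g' _ _ h h' =>
        rw [map_add]
        exact Submodule.add_mem _ h h'
      | smul c g _ h =>
        rw [map_smul]
        exact Submodule.smul_mem _ c h
    · rw [← map_sub]
      rw [le_div_iff₀ (by positivity)] at hfs
      exact (hM _).trans (by nlinarith [norm_nonneg (f - s)])

end RepToMeasure

/-! ### Characters of `C₀(X, K)` -/

section Characters

open TopologicalSpace

variable {K : Type u} [NontriviallyNormedField K] {X : Type w} [TopologicalSpace X]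

/-- Automatic continuity of characters: if `‖f‖ < 1` then `f` has the quasi-inverse
`g = f / (1 - f)`, and `g = f + f * g` excludes that the character takes the value `1` at `f`. -/
theorem norm_character_apply_le (ψ : C₀(X, K) →ₙₐ[K] K) (f : C₀(X, K)) : ‖ψ f‖ ≤ ‖f‖ := by
  by_contra! h
  have h0 : 0 < ‖ψ f‖ := (norm_nonneg f).trans_lt h
  have h0' : ψ f ≠ 0 := norm_pos_iff.1 h0
  set b : C₀(X, K) := (ψ f)⁻¹ • f with hb
  have hb1 : ‖b‖ < 1 := by
    rw [hb, norm_smul, norm_inv, inv_mul_lt_one₀ h0]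
    exact h
  have hψb : ψ b = 1 := by rw [hb, map_smul, smul_eq_mul, inv_mul_cancel₀ h0']
  have hne : ∀ t, 1 - b t ≠ 0 := fun t ht => by
    have h1 := (norm_apply_le b t).trans_lt hb1
    rw [← sub_eq_zero.1 ht, norm_one] at h1
    exact lt_irrefl _ h1
  let g : C₀(X, K) :=
    { toFun := fun t => (1 - b t)⁻¹ * b t
      continuous_toFun := ((continuous_const.sub (map_continuous b)).inv₀ hne).mul
        (map_continuous b)
      zero_at_infty' := by
        have h1 : Filter.Tendsto (fun t => 1 - b t) (Filter.cocompact X) (nhds (1 - 0)) :=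
          tendsto_const_nhds.sub b.zero_at_infty'
        simpa using (h1.inv₀ (by simp)).mul b.zero_at_infty' }
  have hg : g = b + b * g := by
    ext t
    change (1 - b t)⁻¹ * b t = b t + b t * ((1 - b t)⁻¹ * b t)
    have := hne t
    field_simp
    ring
  have := congrArg ψ hg
  rw [map_add, map_mul, hψb, one_mul] at this
  exact one_ne_zero (right_eq_add.1 this)

/-- Evaluation at a point. -/
def evalHom (K : Type u) [NontriviallyNormedField K] (t : X) : C₀(X, K) →ₙₐ[K] K where
  toFun f := f t
  map_smul' _ _ := rfl
  map_zero' := rfl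
  map_add' _ _ := rfl
  map_mul' _ _ := rfl

@[simp] theorem evalHom_apply (t : X) (f : C₀(X, K)) : evalHom K t f = f t := rfl

variable [T2Space X] [IsUltrametricDist K]

/-- Characters are determined by their values on compact open sets. -/
theorem character_ext {ψ ψ' : C₀(X, K) →ₙₐ[K] K}
    (h : ∀ U : CompactOpens X, ψ (compactOpenChar U) = ψ' (compactOpenChar U)) : ψ = ψ' := by
  ext f
  refine sub_eq_zero.1 (norm_le_zero_iff.1 (le_of_forall_pos_le_add fun ε hε => ?_))
  obtain ⟨s, hs, hfs⟩ := exists_mem_span_char_norm_sub_le f (half_pos hε)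
  have hss : ψ s = ψ' s := by
    clear hfs
    induction hs using Submodule.span_induction with
    | mem g hg =>
      obtain ⟨U, rfl⟩ := hg
      exact h U
    | zero => rw [map_zero, map_zero]
    | add g g' _ _ h h' => rw [map_add, map_add, h, h']
    | smul c g _ h => rw [map_smul, map_smul, h]
  have h1 : ψ f - ψ' f = ψ (f - s) - ψ' (f - s) := by rw [map_sub, map_sub, hss]; ring
  calc ‖ψ f - ψ' f‖ ≤ ε / 2 + ε / 2 := by
        rw [h1]
        exact norm_sub_le_of_le ((norm_character_apply_le ψ _).trans hfs)
          ((norm_character_apply_le ψ' _).trans hfs)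
    _ = 0 + ε := by ring

/-- Every nonzero character is an evaluation: the compact open sets on whose characteristic function
it takes the value `1` have the finite intersection property. -/
theorem exists_eq_evalHom {ψ : C₀(X, K) →ₙₐ[K] K} (hψ : ψ ≠ 0) : ∃ t, ψ = evalHom K t := by
  have h01 : ∀ U : CompactOpens X, ψ (compactOpenChar U) = 0 ∨ ψ (compactOpenChar U) = 1 := by
    intro U
    have := congrArg ψ (compactOpenChar_mul_self (K := K) U)
    rw [map_mul] at this
    rcases eq_or_ne (ψ (compactOpenChar U)) 0 with h | h
    · exact Or.inl h
    · exact Or.inr (mul_left_cancel₀ h (this.trans (mul_one _).symm))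
  obtain ⟨U₀, hU₀⟩ : ∃ U : CompactOpens X, ψ (compactOpenChar U) = 1 := by
    by_contra! h
    exact hψ (character_ext fun U => by simpa [h U] using h01 U)
  have hmul : ∀ U U' : CompactOpens X, ψ (compactOpenChar (compactOpenInter U U'
      (isClopen_compactOpen U'))) = ψ (compactOpenChar U) * ψ (compactOpenChar U') := by
    intro U U'
    rw [← map_mul]
    congr 1
    ext t
    by_cases h : t ∈ (U : Set X) <;> by_cases h' : t ∈ (U' : Set X) <;> simp [h, h']
  let S := {U : CompactOpens X // ψ (compactOpenChar U) = 1}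
  have : Nonempty S := ⟨⟨U₀, hU₀⟩⟩
  have hne : ((U₀ : Set X) ∩ ⋂ U : S, (U.1 : Set X)).Nonempty := by
    rw [Set.nonempty_iff_ne_empty]
    intro hempty
    obtain ⟨U, hU⟩ := U₀.isCompact.elim_directed_family_closed (fun U : S => (U.1 : Set X))
      (fun U => (isClopen_compactOpen U.1).isClosed) hempty (fun U U' =>
        ⟨⟨compactOpenInter U.1 U'.1 (isClopen_compactOpen U'.1), by rw [hmul, U.2, U'.2, one_mul]⟩,
          Set.inter_subset_left, Set.inter_subset_right⟩)
    have h1 := hmul U₀ U.1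
    rw [hU₀, U.2, one_mul] at h1
    refine one_ne_zero (h1.symm.trans ?_)
    rw [← map_zero ψ]
    congr 1
    ext t
    simp [hU]
  obtain ⟨t, ht₀, ht⟩ := hne
  rw [Set.mem_iInter] at ht
  refine ⟨t, character_ext fun U => ?_⟩
  by_cases htU : t ∈ (U : Set X)
  · rw [evalHom_apply, compactOpenChar_apply, Set.indicator_of_mem htU]
    refine (h01 U).resolve_left fun hU => ?_
    -- otherwise the character takes the value `1` on `U₀ \ U`, which does not contain `t`
    have hdiff := congrArg ψ (show compactOpenChar (K := K) U₀ =
        compactOpenChar (compactOpenInter U₀ Uᶜ (isClopen_compactOpen U).compl) +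
          compactOpenChar (compactOpenInter U₀ U (isClopen_compactOpen U)) by
      ext t
      by_cases h : t ∈ (U₀ : Set X) <;> by_cases h' : t ∈ (U : Set X) <;> simp [h, h'])
    rw [map_add, hmul, hU, mul_zero, add_zero, hU₀] at hdiff
    exact (ht ⟨_, hdiff.symm⟩).2 htU
  · rw [evalHom_apply, compactOpenChar_apply, Set.indicator_of_notMem htU]
    exact (h01 U).resolve_right fun hU => htU (ht ⟨U, hU⟩)

end Characters

/-! ### Transpositions of a `C`-algebra -/

section Transposition

variable {K : Type u} [NontriviallyNormedField K]
variable {A : Type v} [NonUnitalNormedCommRing A] [NormedSpace K A] {tr : A → A}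

namespace IsETransposition

theorem map_sub (htr : IsETransposition K tr) (a b : A) : tr (a - b) = tr a - tr b := by
  have := htr.map_add (a - b) b
  rw [sub_add_cancel] at this
  exact eq_sub_of_add_eq this.symm

theorem norm_le_norm_map (htr : IsETransposition K tr) (a : A) : ‖a‖ ≤ ‖tr a‖ := by
  rcases (norm_nonneg a).eq_or_lt with h | h
  · rw [← h]
    exact norm_nonneg _
  · refine le_of_mul_le_mul_right ?_ h
    rw [← sq, ← htr.norm_mul_self]
    exact norm_mul_le _ _

theorem norm_map (htr : IsETransposition K tr) (a : A) : ‖tr a‖ = ‖a‖ := by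
  refine le_antisymm ?_ (htr.norm_le_norm_map a)
  conv_rhs => rw [← htr.involutive a]
  exact htr.norm_le_norm_map _

/-- Idempotents are symmetric: for the idempotent `r = p - pᵗ p` the product `rᵗ r` vanishes,
so `r = 0`. -/
theorem map_eq_self_of_idempotent (htr : IsETransposition K tr) {p : A} (hp : p * p = p) :
    tr p = p := by
  set q := tr p with hq
  have hqq : q * q = q := by rw [hq, ← htr.map_mul, hp]
  have hqp : tr (q * p) = q * p := by rw [htr.map_mul, hq, htr.involutive]
  have h0 : tr (p - q * p) * (p - q * p) = 0 := by
    rw [htr.map_sub, hqp, ← hq]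
    have e1 : q * (q * p) = q * p := by rw [← mul_assoc, hqq]
    have e2 : q * p * p = q * p := by rw [mul_assoc, hp]
    have e3 : q * p * (q * p) = q * p := by rw [mul_mul_mul_comm, hqq, hp]
    rw [sub_mul, mul_sub, mul_sub, e1, e2, e3, sub_self]
  have hr : p = q * p := by
    have h := htr.norm_mul_self (p - q * p)
    rw [h0, norm_zero, eq_comm, sq_eq_zero_iff, norm_eq_zero] at h
    exact sub_eq_zero.1 h
  calc q = tr (q * p) := by rw [← hr]
    _ = q * p := hqp
    _ = p := hr.symm

/-- On a `C`-algebra, whose idempotents span a dense subspace, the `E`-property leaves only the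
identity as transposition. -/
theorem eq_self [IsUltrametricDist K] {X : Type w} [TopologicalSpace X] [T2Space X]
    (htr : IsETransposition K tr) {e : A →ₙₐ[K] C₀(X, K)} (he : Isometry e)
    (hsurj : Function.Surjective e) (a : A) : tr a = a := by
  have hspan : ∀ s ∈ Submodule.span K (Set.range (compactOpenChar (K := K) (X := X))),
      ∃ b, e b = s ∧ tr b = b := by
    intro s hs
    induction hs using Submodule.span_induction with
    | mem g hg =>
      obtain ⟨U, rfl⟩ := hg
      obtain ⟨b, hb⟩ := hsurj (compactOpenChar U)
      refine ⟨b, hb, htr.map_eq_self_of_idempotent (he.injective ?_)⟩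
      rw [map_mul, hb, compactOpenChar_mul_self]
    | zero => exact ⟨0, map_zero e, by simpa using htr.map_sub 0 0⟩
    | add g g' _ _ h h' =>
      obtain ⟨b, hb, hb'⟩ := h
      obtain ⟨c, hc, hc'⟩ := h'
      exact ⟨b + c, by rw [_root_.map_add, hb, hc], by rw [htr.map_add, hb', hc']⟩
    | smul k g _ h =>
      obtain ⟨b, hb, hb'⟩ := h
      exact ⟨k • b, by rw [_root_.map_smul, hb], by rw [htr.map_smul, hb']⟩
  refine sub_eq_zero.1 (norm_le_zero_iff.1 (le_of_forall_pos_le_add fun ε hε => ?_))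
  obtain ⟨s, hs, has⟩ := exists_mem_span_char_norm_sub_le (e a) (half_pos hε)
  obtain ⟨b, rfl, hb⟩ := hspan s hs
  rw [← _root_.map_sub, he.norm_map_of_map_zero (map_zero e)] at has
  have h1 : tr a - a = tr (a - b) - (a - b) := by rw [htr.map_sub, hb]; abel
  calc ‖tr a - a‖ ≤ ε / 2 + ε / 2 := by
        rw [h1]
        exact norm_sub_le_of_le ((htr.norm_map _).trans_le has) has
    _ = 0 + ε := by ring

end IsETransposition

end Transposition

/-! ### The Gelfand isomorphism -/

section Gelfand

open TopologicalSpace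

variable {K : Type u} [NontriviallyNormedField K] [IsUltrametricDist K]
variable {A : Type v} [NonUnitalNormedCommRing A] [NormedSpace K A] {tr : A → A}
variable {X : Type w} [TopologicalSpace X] [T2Space X] [LocallyCompactSpace X]
  [TotallyDisconnectedSpace X]

/-- The point evaluations identify `X` with the symmetric spectrum of `C₀(X, K)`. -/
theorem exists_homeomorph_symmSpectrum (htr : IsETransposition K tr) {e : A →ₙₐ[K] C₀(X, K)}
    (he : Isometry e) (hsurj : Function.Surjective e) :
    ∃ h : X ≃ₜ SymmSpectrum K tr, ∀ t a, (h t).1 a = e a t := by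
  have hsep : ∀ (t : X) (W : Set X), IsOpen W → t ∈ W →
      ∃ a, e a t = 1 ∧ ∀ t', e a t' ≠ 0 → t' ∈ W := by
    intro t W hW ht
    obtain ⟨U, htU, hUW⟩ := exists_compactOpen_mem_subset hW ht
    obtain ⟨a, ha⟩ := hsurj (compactOpenChar U)
    refine ⟨a, ?_, fun t' ht' => hUW ?_⟩
    · rw [ha, compactOpenChar_apply]
      exact Set.indicator_of_mem htU _
    · rw [ha, compactOpenChar_apply] at ht'
      exact Set.mem_of_indicator_ne_zero ht'
  let F : X → SymmSpectrum K tr := fun t => ⟨(evalHom K t).comp e, by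
    obtain ⟨a, ha, -⟩ := hsep t _ isOpen_univ trivial
    refine fun h0 => one_ne_zero (α := K) ?_
    rw [← ha]
    exact DFunLike.congr_fun h0 a, fun a => by rw [htr.eq_self he hsurj]⟩
  have hF : ∀ t a, (F t).1 a = e a t := fun _ _ => rfl
  have hinj : Function.Injective F := by
    intro t t' h
    by_contra hne
    obtain ⟨a, ha, ha'⟩ := hsep t _ (isOpen_compl_singleton (x := t')) hne
    refine ha' t' ?_ rfl
    rw [← hF, ← h, hF, ha]
    exact one_ne_zero
  obtain ⟨g, hg⟩ := hsurj.hasRightInverse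
  have hg' : Function.LeftInverse g e := fun a => he.injective (hg _)
  have hFsurj : Function.Surjective F := by
    intro φ
    have hne : φ.1.comp (NonUnitalAlgHom.inverse e g hg' hg) ≠ 0 := by
      refine fun h0 => φ.2.1 ?_
      ext a
      have h1 := DFunLike.congr_fun h0 (e a)
      have h2 : φ.1 (g (e a)) = 0 := h1
      rwa [hg'] at h2
    obtain ⟨t, ht⟩ := exists_eq_evalHom hne
    refine ⟨t, Subtype.ext ?_⟩
    ext a
    have h1 : φ.1 (g (e a)) = e a t := DFunLike.congr_fun ht (e a)
    rw [hg'] at h1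
    rw [hF, h1]
  have hind : Topology.IsInducing F := by
    have hcoe : Topology.IsInducing (fun (φ : SymmSpectrum K tr) (a : A) => φ.1 a) := ⟨rfl⟩
    rw [← hcoe.of_comp_iff, Topology.isInducing_iff_nhds]
    intro t
    have hcont : Continuous fun (t : X) (a : A) => e a t :=
      continuous_pi fun a => map_continuous (e a)
    refine le_antisymm (hcont.tendsto t).le_comap fun W hW => ?_
    obtain ⟨W', hW'W, hW', htW'⟩ := mem_nhds_iff.1 hW
    obtain ⟨a, ha, ha'⟩ := hsep t W' hW' htW'
    refine Filter.mem_comap.2 ⟨{y | y a ≠ 0},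
      (isOpen_ne.preimage (continuous_apply a)).mem_nhds ?_, fun t' ht' => hW'W (ha' t' ht')⟩
    change e a t ≠ 0
    rw [ha]
    exact one_ne_zero
  exact ⟨(Equiv.ofBijective F ⟨hinj, hFsurj⟩).toHomeomorphOfIsInducing hind, hF⟩

omit [IsUltrametricDist K] [T2Space X] [LocallyCompactSpace X] [TotallyDisconnectedSpace X] in
/-- A homeomorphism of `X` with the spectrum turns the given isomorphism `A ≃ C₀(X, K)` into the
Gelfand transform. -/
theorem exists_gelfand_hom (h : X ≃ₜ SymmSpectrum K tr) {e : A →ₙₐ[K] C₀(X, K)}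
    (he : Isometry e) (hsurj : Function.Surjective e) (heval : ∀ t a, (h t).1 a = e a t) :
    ∃ Γ : A →ₙₐ[K] C₀(SymmSpectrum K tr, K), Isometry Γ ∧ Function.Surjective Γ ∧
      ∀ a, ⇑(Γ a) = gelfand K tr a := by
  let Γ : A →ₙₐ[K] C₀(SymmSpectrum K tr, K) :=
    (ZeroAtInftyContinuousMap.compNonUnitalAlgHom h.symm.toCocompactMap).comp e
  have hΓ : ∀ a φ, Γ a φ = e a (h.symm φ) := fun _ _ => rfl
  refine ⟨Γ, AddMonoidHomClass.isometry_of_norm Γ fun a => le_antisymm ?_ ?_, fun f => ?_,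
    fun a => ?_⟩
  · refine norm_le_of_forall_apply (norm_nonneg _) fun φ => ?_
    rw [hΓ, ← he.norm_map_of_map_zero (map_zero e)]
    exact norm_apply_le _ _
  · rw [← he.norm_map_of_map_zero (map_zero e)]
    refine norm_le_of_forall_apply (norm_nonneg _) fun t => ?_
    have := norm_apply_le (Γ a) (h t)
    rwa [hΓ, h.symm_apply_apply] at this
  · obtain ⟨a, ha⟩ := hsurj (f.comp h.toCocompactMap)
    refine ⟨a, ?_⟩
    ext φ
    rw [hΓ, ha]
    exact congrArg f (h.apply_symm_apply φ)
  · ext φ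
    rw [hΓ, ← heval, h.apply_symm_apply]
    rfl

end Gelfand

/-! ### Transfer along the Gelfand isomorphism -/

section Transfer

open TopologicalSpace

variable {K : Type u} [NontriviallyNormedField K]
variable {A : Type v} [NonUnitalNormedCommRing A] [NormedSpace K A]
variable {X : Type w} [TopologicalSpace X] [T2Space X]
variable {H : Type x} [NormedAddCommGroup H] [NormedSpace K H]
variable {Γ : A →ₙₐ[K] C₀(X, K)} {T : A →ₙₐ[K] (H →L[K] H)}
variable {L L' : Set (Set X)} {P P' : Set X → (H →L[K] H)}

theorem IsNondegenerateRep.exists_measure_of_isometry [IsUltrametricDist K] [CompleteSpace H]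
    (hT : IsNondegenerateRep T) (hΓ : Isometry Γ) (hsurj : Function.Surjective Γ) :
    ∃ P : Set X → (H →L[K] H), IsRegularTight {V : Set X | IsClopen V} P ∧
      ∀ a : A, HasSpectralIntegral {V : Set X | IsClopen V} P (Γ a) (T a) := by
  obtain ⟨g, hg⟩ := hsurj.hasRightInverse
  have hg' : Function.LeftInverse g Γ := fun a => hΓ.injective (hg _)
  set T' : C₀(X, K) →ₙₐ[K] (H →L[K] H) := T.comp (NonUnitalAlgHom.inverse Γ g hg' hg)
  have hT'Γ : ∀ a, T' (Γ a) = T a := fun a => congrArg T (hg' a)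
  have hT' : IsNondegenerateRep T' := by
    refine ⟨hT.continuous.comp (hΓ.right_inv hg).continuous, ?_⟩
    rw [eq_top_iff, ← hT.dense_span]
    refine Submodule.topologicalClosure_mono (Submodule.span_mono ?_)
    rintro _ ⟨a, ξ, rfl⟩
    exact ⟨Γ a, ξ, by rw [hT'Γ]⟩
  obtain ⟨P, hP, hPT⟩ := hT'.exists_measure
  exact ⟨P, hP, fun a => hT'Γ a ▸ hPT (Γ a)⟩

theorem IsRegularTight.map_compactOpen_eq [IsUltrametricDist H] (hP : IsRegularTight L P)
    (h : ∀ a, HasSpectralIntegral L P (Γ a) (T a)) {U : CompactOpens X} {a : A}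
    (ha : Γ a = compactOpenChar U) : P U = T a :=
  (ha ▸ hP.hasSpectralIntegral_char U).unique hP.toIsProjectionMeasure (h a)

variable [LocallyCompactSpace X] [TotallyDisconnectedSpace X]

theorem IsRegularTight.eq_of_hasSpectralIntegral [IsUltrametricDist H] (hsurj : Function.Surjective Γ)
    (hP : IsRegularTight L P) (hP' : IsRegularTight L' P')
    (h : ∀ a, HasSpectralIntegral L P (Γ a) (T a))
    (h' : ∀ a, HasSpectralIntegral L' P' (Γ a) (T a)) {V : Set X} (hV : V ∈ L) (hV' : V ∈ L') :
    P V = P' V := by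
  refine hP.eq_of_forall_compactOpen hP' (fun U => ?_) hV hV'
  obtain ⟨a, ha⟩ := hsurj (compactOpenChar U)
  rw [hP.map_compactOpen_eq h ha, hP'.map_compactOpen_eq h' ha]

theorem IsRegularTight.contractive_iff [IsUltrametricDist H] (hΓ : Isometry Γ) (hsurj : Function.Surjective Γ)
    (hP : IsRegularTight L P) (h : ∀ a, HasSpectralIntegral L P (Γ a) (T a)) :
    (∀ a : A, ‖T a‖ ≤ ‖a‖) ↔ ∀ V ∈ L, ‖P V‖ ≤ 1 := by
  constructor
  · intro hT V hV
    refine hP.norm_le_of_forall_compactOpen zero_le_one (fun U => ?_) hV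
    obtain ⟨a, ha⟩ := hsurj (compactOpenChar U)
    rw [hP.map_compactOpen_eq h ha]
    refine (hT a).trans ?_
    rw [← hΓ.norm_map_of_map_zero (map_zero Γ), ha]
    exact norm_compactOpenChar_le U
  · intro hM a
    simpa using (h a).norm_le_of_isometry hP.toIsProjectionMeasure hM hΓ

end Transfer

end NonArchSpectral

theorem theorem5p12
    (K : Type u) [NontriviallyNormedField K] [IsUltrametricDist K] [LocallyCompactSpace K]
    (A : Type v) [NonUnitalNormedCommRing A] [NormedSpace K A] [IsScalarTower K A A]
    [SMulCommClass K A A] [CompleteSpace A]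
    (hA : NonArchSpectral.IsCAlgebra.{u, v, w} K A)
    (tr : A → A) (htr : NonArchSpectral.IsETransposition K tr)
    (H : Type x) [NormedAddCommGroup H] [NormedSpace K H] [IsUltrametricDist H]
    [CompleteSpace H] :
    -- a regular tight measure gives a non-degenerate representation by spectral integration
    (∀ (L : Set (Set (NonArchSpectral.SymmSpectrum K tr)))
        (P : Set (NonArchSpectral.SymmSpectrum K tr) → (H →L[K] H)),
        NonArchSpectral.IsRegularTight L P →
        ∃ T : A →ₙₐ[K] (H →L[K] H), NonArchSpectral.IsNondegenerateRep T ∧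
          ∀ (a : A) (E : H →L[K] H),
            NonArchSpectral.HasSpectralIntegral L P (NonArchSpectral.gelfand K tr a) E ↔
              E = T a) ∧
    -- a non-degenerate representation comes from a regular tight measure, which is unique
    (∀ T : A →ₙₐ[K] (H →L[K] H), NonArchSpectral.IsNondegenerateRep T →
        (∃ P : Set (NonArchSpectral.SymmSpectrum K tr) → (H →L[K] H),
          NonArchSpectral.IsRegularTight
            {V : Set (NonArchSpectral.SymmSpectrum K tr) | IsClopen V} P ∧
          ∀ a : A, NonArchSpectral.HasSpectralIntegral
            {V : Set (NonArchSpectral.SymmSpectrum K tr) | IsClopen V} P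
            (NonArchSpectral.gelfand K tr a) (T a)) ∧
        (∀ (L L' : Set (Set (NonArchSpectral.SymmSpectrum K tr)))
          (P P' : Set (NonArchSpectral.SymmSpectrum K tr) → (H →L[K] H)),
          NonArchSpectral.IsRegularTight L P → NonArchSpectral.IsRegularTight L' P' →
          (∀ a : A, NonArchSpectral.HasSpectralIntegral L P
            (NonArchSpectral.gelfand K tr a) (T a)) →
          (∀ a : A, NonArchSpectral.HasSpectralIntegral L' P'
            (NonArchSpectral.gelfand K tr a) (T a)) →
          ∀ V ∈ L, V ∈ L' → P V = P' V)) ∧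
    -- contractive representations correspond to measures with values of norm at most one
    (∀ (T : A →ₙₐ[K] (H →L[K] H)) (L : Set (Set (NonArchSpectral.SymmSpectrum K tr)))
        (P : Set (NonArchSpectral.SymmSpectrum K tr) → (H →L[K] H)),
        NonArchSpectral.IsNondegenerateRep T → NonArchSpectral.IsRegularTight L P →
        (∀ a : A, NonArchSpectral.HasSpectralIntegral L P
          (NonArchSpectral.gelfand K tr a) (T a)) →
        ((∀ a : A, ‖T a‖ ≤ ‖a‖) ↔ ∀ V ∈ L, ‖P V‖ ≤ 1)) := by
  obtain ⟨X, _, _, _, _, e, he, hsurj⟩ := hA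
  obtain ⟨h, heval⟩ := NonArchSpectral.exists_homeomorph_symmSpectrum htr he hsurj
  obtain ⟨Γ, hΓ, hΓsurj, hΓa⟩ := NonArchSpectral.exists_gelfand_hom h he hsurj heval
  have : T2Space (NonArchSpectral.SymmSpectrum K tr) := h.symm.isEmbedding.t2Space
  have : LocallyCompactSpace (NonArchSpectral.SymmSpectrum K tr) :=
    h.symm.isClosedEmbedding.locallyCompactSpace
  have : TotallyDisconnectedSpace (NonArchSpectral.SymmSpectrum K tr) :=
    h.totallyDisconnectedSpace
  simp only [← hΓa]
  exact ⟨fun L P hP => hP.exists_rep hΓ hΓsurj,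
    fun T hT => ⟨hT.exists_measure_of_isometry hΓ hΓsurj, fun L L' P P' hP hP' hI hI' V hV hV' =>
      hP.eq_of_hasSpectralIntegral hΓsurj hP' hI hI' hV hV'⟩,
    fun T L P _ hP hI => hP.contractive_iff hΓ hΓsurj hI⟩
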